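/- **Lemma 4.2 (approximate Stein's lemma).** Let $\gamma=\mathcal N(0,I_d)$ on $\mathbb R^d$ with density $\mu_\gamma$, let $He_j(x)=\frac{(-1)^j}{\sqrt{j!}}\frac{\nabla^j\mu_\gamma(x)}{\mu_\gamma(x)}\in(\mathbb R^d)^{\otimes j}$ be the $j$-th Hermite tensor, and for $f\in L^2(\gamma)$ let $(\mathcal P_jf)(x)=\langle \mathbb E_{y\sim\gamma}[f(y)He_j(y)],He_j(x)\rangle$ and $\mathcal P_{<k}=\sum_{0\le j<k}\mathcal P_j$. Fix integers $k\ge 2$, $q\ge 0$ and real constants $G,B,c_1,c_2$ with $c_1>0$. There is a constant $C>0$, depending only on $k,q,G,B,c_1,c_2$, such that the following holds for every $d$. Let $$p(x)=\frac1{\sqrt L}\sum_{i=1}^L\lambda_i\psi_i(x),\qquad x\in\mathbb R^d,$$ where $\lambda_i\in\mathbb R$ and $\psi_i:\mathbb R^d\to\mathbb R$ satisfy: * there is a family of orthonormal vectors $\{v_{i,j}\}_{i\in[L],\,j\in[J_i]}$ in $\mathbb R^d$ with $J_i\le k$, such that $\psi_i(x)$ depends only on $v_{i,1}^\top x,\dots,v_{i,J_i}^\top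 x$; * $\mathcal P_k\psi_i=\psi_i$ for each $i$ (so $\psi_i$ is a polynomial in the span of the degree-$k$ Hermite polynomials); * $\mathbb E_{x\sim\gamma}[\psi_i(x)^2]=1$ for each $i$, and $\mathbb E_{x\sim\gamma}[p(x)^2]=1$; * $|\lambda_i|\le B$ for each $i$, and $c_1d\le L\le c_2d$. Let $g(z)=\sum_{0\le i\le q}g_iz^i$ be a real polynomial with $|g_i|\le G$ for all $i$, let $h=g\circ p$, and assume $\mathbb E_{x\sim\gamma}[h(x)]=0$. Then $$\big\|\mathcal P_kh-\mathbb E_{z\sim\mathcal N(0,1)}[g'(z)]\,p\big\|_{L^2(\gamma)}\le C\,d^{-1/2}\qquad\text{and}\qquad \|\mathcal P_{<k}h\|_{L^2(\gamma)}\le C\,d^{-1/2}.$$ -/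

import Mathlib

open MeasureTheory ProbabilityTheory
open scoped ENNReal

namespace HierPoly

/-- The input space `ℝ^d` with its Euclidean norm. -/
abbrev E (d : ℕ) : Type := EuclideanSpace ℝ (Fin d)

/-- The input distribution `γ = N(0, I_d)`. -/
noncomputable abbrev gam (d : ℕ) : Measure (E d) := stdGaussian (E d)

/-- The Lebesgue density of `N(0, I_d)`. -/
noncomputable def gaussDensity (d : ℕ) (x : E d) : ℝ :=
  Real.exp (-(1 / 2) * ‖x‖ ^ 2) / (2 * Real.pi) ^ ((d : ℝ) / 2)

/-- The entry with index `a = (a_1, …, a_k) ∈ [d]^k` of the `k`-th Hermite tensor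
`He_k(x) = (-1)^k / √(k!) · ∇^k μ(x) / μ(x)`, where `μ` is the density of `N(0, I_d)`. -/
noncomputable def hermiteTensor {d : ℕ} (k : ℕ) (x : E d) (a : Fin k → Fin d) : ℝ :=
  (-1) ^ k / Real.sqrt (k.factorial : ℝ) *
    (iteratedFDeriv ℝ k (gaussDensity d) x (fun j => EuclideanSpace.single (a j) (1 : ℝ)) /
      gaussDensity d x)

/-- The entries of the coefficient tensor `C_k(f) = 𝔼_{x ∼ γ}[f(x) He_k(x)]`, for `f ∈ L²(γ)`. -/
noncomputable def hermiteCoeff {d : ℕ} (k : ℕ) (f : E d → ℝ) (a : Fin k → Fin d) : ℝ :=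
  ∫ x, f x * hermiteTensor k x a ∂(gam d)

/-- The projection `(P_k f)(x) = ⟨C_k(f), He_k(x)⟩` onto the span of the Hermite polynomials of
degree `k`, for `f ∈ L²(γ)`. The value is an everywhere defined polynomial function. -/
noncomputable def hermiteProj {d : ℕ} (k : ℕ) (f : E d → ℝ) (x : E d) : ℝ :=
  ∑ a : Fin k → Fin d, hermiteCoeff k f a * hermiteTensor k x a

/-- `P_{<k} = ∑_{0 ≤ i < k} P_i`. -/
noncomputable def hermiteProjLT {d : ℕ} (k : ℕ) (f : E d → ℝ) (x : E d) : ℝ :=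
  ∑ i ∈ Finset.range k, hermiteProj i f x

/-- The feature `p(x) = L^{-1/2} ∑_{i=1}^L lam_i ψ_i(x)`. -/
noncomputable def feature {d L : ℕ} (lam : Fin L → ℝ) (ψ : Fin L → E d → ℝ) (x : E d) : ℝ :=
  1 / Real.sqrt (L : ℝ) * ∑ i, lam i * ψ i x

/-- The assumptions on the feature. The constants `B` and `c₁, c₂` are those hidden in
`sup_i |lam_i| = O(1)` and `L = Θ(d)`. -/
structure FeatureAssumption (k : ℕ) (B c₁ c₂ : ℝ) (d L : ℕ) (J : Fin L → ℕ)
    (v : (i : Fin L) → Fin (J i) → E d) (lam : Fin L → ℝ) (ψ : Fin L → E d → ℝ) : Prop where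
  /-- each group has at most `k` directions -/
  card_le : ∀ i, J i ≤ k
  /-- all the vectors `v_{i,j}` together are unit vectors orthogonal to each other -/
  orthonormal : Orthonormal ℝ (fun ij : (i : Fin L) × Fin (J i) => v ij.1 ij.2)
  /-- `ψ_i(x)` only depends on `v_{i,1}ᵀ x, …, v_{i,J_i}ᵀ x` -/
  dependsOn : ∀ i (x y : E d), (∀ j, inner ℝ (v i j) x = inner ℝ (v i j) y) → ψ i x = ψ i y
  /-- `P_k ψ_i = ψ_i`; in particular `ψ_i` is a polynomial, hence in `L²(γ)` -/
  proj_eq : ∀ i, hermiteProj k (ψ i) = ψ i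
  /-- `𝔼[ψ_i²] = 1` -/
  component_normalized : ∀ i, ∫ x, ψ i x ^ 2 ∂(gam d) = 1
  /-- `𝔼[p²] = 1` -/
  feature_normalized : ∫ x, feature lam ψ x ^ 2 ∂(gam d) = 1
  /-- `sup_i |lam_i| = O(1)` -/
  balanced : ∀ i, |lam i| ≤ B
  /-- `L = Ω(d)` -/
  le_card : c₁ * d ≤ L
  /-- `L = O(d)` -/
  card_le_mul : (L : ℝ) ≤ c₂ * d

end HierPoly

namespace HierPoly

open MvPolynomial (X C pderiv)

/-! Write `p = ∑ ε_i` with independent `ε_i = λ_i ψ_i / √L` in the `k`-th chaos, and let `κ_n` be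
the Gaussian moments. By linearity in `g` it suffices that, on the chaoses of degree at most `k`,
`p^n` equals `κ_n + n κ_{n-1} p` up to `O(L^{-1/2})` in `L²` (`small_chaosProj_defect`); the
coefficients `g_n n κ_{n-1}` sum to `𝔼[g'(z)]`, and the mean of `h` vanishes by assumption.

The powers are handled by a two-step induction. Write `p^{n+2} = ∑ ε_i p^{n+1}` and compare
`p^{n+1}` with `(p - ε_i)^{n+1}`, which is independent of `ε_i` (`defect_add_two`). Three terms
result: (a) `∑ ε_i (p - ε_i)^{n+1}`. If `F` is in the `k`-th chaos, `G` is independent of `F` and `j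
≤ k`, then `P_j (F G) = 𝔼[G] P_j F` (`chaosProj_mul`), so only the means of `(p - ε_i)^{n+1}`
matter, and these are close to `κ_{n+1}` by induction. (b) `(n+1) (∑ ε_i²) p^n`, where `∑ ε_i²`
concentrates at `1`. (c) A cubic remainder: `L` terms of size `L^{-3/2}`. The recursion `κ_{n+2} =
(n+1) κ_n` closes the induction.

Uniformity in the dimension comes from equivalence of moments on a fixed chaos (`exists_ex_pow_le`).
All functions involved are polynomials, so the argument runs in `MvPolynomial` with the expectation
functional `ex`, using integration by parts. -/

/-- The polynomial function on `ℝ^d` attached to a polynomial in `d` variables. -/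
noncomputable def ev {d : ℕ} (F : MvPolynomial (Fin d) ℝ) (x : E d) : ℝ :=
  MvPolynomial.eval (fun i => x i) F

section ev

variable {d : ℕ} (F F' : MvPolynomial (Fin d) ℝ) (x : E d)

@[simp] lemma ev_add : ev (F + F') x = ev F x + ev F' x := by simp [ev]
@[simp] lemma ev_sub : ev (F - F') x = ev F x - ev F' x := by simp [ev]
@[simp] lemma ev_mul : ev (F * F') x = ev F x * ev F' x := by simp [ev]
@[simp] lemma ev_pow (n : ℕ) : ev (F ^ n) x = ev F x ^ n := by simp [ev]
@[simp] lemma ev_zero : ev (0 : MvPolynomial (Fin d) ℝ) x = 0 := by simp [ev]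
@[simp] lemma ev_one : ev (1 : MvPolynomial (Fin d) ℝ) x = 1 := by simp [ev]
@[simp] lemma ev_C (a : ℝ) : ev (C a : MvPolynomial (Fin d) ℝ) x = a := by simp [ev]
@[simp] lemma ev_X (i : Fin d) : ev (X i : MvPolynomial (Fin d) ℝ) x = x i := by simp [ev]
@[simp] lemma ev_smul (a : ℝ) : ev (a • F) x = a * ev F x := by simp [ev]
@[simp] lemma ev_sum {ι : Type*} (s : Finset ι) (f : ι → MvPolynomial (Fin d) ℝ) :
    ev (∑ i ∈ s, f i) x = ∑ i ∈ s, ev (f i) x := by simp [ev]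

lemma continuous_ev : Continuous (ev F) := by
  unfold ev
  exact (MvPolynomial.continuous_eval F).comp (by fun_prop)

end ev

/-! ### Gaussian moments and integration by parts -/

/-- The `m`-th moment of the standard Gaussian. -/
noncomputable def gaussMoment (m : ℕ) : ℝ := ∫ z, z ^ m ∂(gaussianReal 0 1)

lemma integrable_pow_gaussianReal (m : ℕ) :
    Integrable (fun z : ℝ => z ^ m) (gaussianReal 0 1) := by
  have h := (memLp_id_gaussianReal' (μ := 0) (v := 1) m (by simp)).integrable_norm_pow'
  refine h.mono (by fun_prop) (Filter.Eventually.of_forall fun z => ?_)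
  simp

@[simp] lemma gaussMoment_zero : gaussMoment 0 = 1 := by simp [gaussMoment]

@[simp] lemma gaussMoment_one : gaussMoment 1 = 0 := by simp [gaussMoment]

lemma hasDerivAt_gaussianPDFReal (x : ℝ) :
    HasDerivAt (gaussianPDFReal 0 1) (-(x * gaussianPDFReal 0 1 x)) x := by
  have h1 : gaussianPDFReal 0 1 = fun x : ℝ =>
      (Real.sqrt (2 * Real.pi))⁻¹ * Real.exp (-x ^ 2 / 2) := by
    ext x; simp [gaussianPDFReal]
  rw [h1]
  have h2 : HasDerivAt (fun x : ℝ => -x ^ 2 / 2) (-x) x := by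
    exact ((hasDerivAt_pow 2 x).fun_neg.div_const 2).congr_deriv (by push_cast; ring)
  exact ((h2.exp).const_mul ((Real.sqrt (2 * Real.pi))⁻¹)).congr_deriv (by ring)

lemma integrable_pow_mul_gaussianPDFReal (m : ℕ) :
    Integrable (fun z : ℝ => z ^ m * gaussianPDFReal 0 1 z) := by
  have h := integrable_pow_gaussianReal m
  rw [gaussianReal_of_var_ne_zero 0 one_ne_zero, integrable_withDensity_iff_integrable_smul'
    (measurable_gaussianPDF 0 1) (by simp [gaussianPDF])] at h
  refine h.congr (Filter.Eventually.of_forall fun z => ?_)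
  simp [toReal_gaussianPDF, mul_comm]

/-- Integration by parts against the density `φ`, using `φ' = -z φ`. -/
lemma gaussMoment_add_two (m : ℕ) : gaussMoment (m + 2) = (m + 1) * gaussMoment m := by
  have hi := integrable_pow_mul_gaussianPDFReal
  have key := integral_mul_deriv_eq_deriv_mul_of_integrable (u := fun z : ℝ => z ^ (m + 1))
    (u' := fun z : ℝ => (m + 1) * z ^ m) (v := gaussianPDFReal 0 1)
    (v' := fun z => -(z * gaussianPDFReal 0 1 z))
    (fun z _ => by simpa using hasDerivAt_pow (m + 1) z) (fun z _ => hasDerivAt_gaussianPDFReal z)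
    (by
      refine (hi (m + 2)).neg.congr (Filter.Eventually.of_forall fun z => ?_)
      simp; ring)
    (by
      refine ((hi m).const_mul (m + 1 : ℝ)).congr (Filter.Eventually.of_forall fun z => ?_)
      simp; ring)
    (hi (m + 1))
  simp only [gaussMoment, integral_gaussianReal_eq_integral_smul one_ne_zero, smul_eq_mul]
  rw [← integral_const_mul, ← neg_inj]
  calc _ = ∫ z : ℝ, z ^ (m + 1) * -(z * gaussianPDFReal 0 1 z) := by
        rw [← integral_neg]; congr 1; ext z; ring
    _ = _ := key
    _ = _ := by congr 2; ext z; ring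

/-- This form also covers `m = 0`, where the factor `m` makes the truncated `m - 1` harmless. -/
lemma gaussMoment_succ (m : ℕ) : gaussMoment (m + 1) = m * gaussMoment (m - 1) := by
  cases m with
  | zero => simp
  | succ m => simpa using gaussMoment_add_two m

lemma integral_gam_eq {d : ℕ} (f : E d → ℝ) (hf : Continuous f) :
    ∫ x, f x ∂(gam d) =
      ∫ y, f (WithLp.toLp 2 y) ∂(Measure.pi fun _ : Fin d => gaussianReal 0 1) := by
  rw [gam, ← map_pi_eq_stdGaussian, integral_map (by fun_prop) (hf.aestronglyMeasurable)]

lemma integrable_ev_monomial {d : ℕ} (s : Fin d →₀ ℕ) (a : ℝ) :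
    Integrable (ev (MvPolynomial.monomial s a)) (gam d) := by
  rw [gam, ← map_pi_eq_stdGaussian, integrable_map_measure
    (continuous_ev _).aestronglyMeasurable (by fun_prop)]
  have := (Integrable.fintype_prod (μ := fun _ : Fin d => gaussianReal 0 1)
    (f := fun i (z : ℝ) => z ^ s i) fun i => integrable_pow_gaussianReal _).const_mul a
  refine this.congr (Filter.Eventually.of_forall fun z => ?_)
  simp [ev, MvPolynomial.eval_monomial, Finsupp.prod_fintype]

lemma integrable_ev {d : ℕ} (F : MvPolynomial (Fin d) ℝ) : Integrable (ev F) (gam d) := by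
  induction F using MvPolynomial.induction_on' with
  | monomial s a => exact integrable_ev_monomial s a
  | add p q hp hq => exact (hp.add hq).congr (Filter.Eventually.of_forall fun z => by simp)

/-- The expectation of a polynomial under the standard Gaussian. -/
noncomputable def ex {d : ℕ} : MvPolynomial (Fin d) ℝ →ₗ[ℝ] ℝ where
  toFun F := ∫ x, ev F x ∂(gam d)
  map_add' F F' := by simp [integral_add (integrable_ev F) (integrable_ev F')]
  map_smul' a F := by simp [integral_const_mul]

lemma ex_apply {d : ℕ} (F : MvPolynomial (Fin d) ℝ) : ex F = ∫ x, ev F x ∂(gam d) := rfl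

lemma ex_mono {d : ℕ} {F F' : MvPolynomial (Fin d) ℝ} (h : ∀ x, ev F x ≤ ev F' x) :
    ex F ≤ ex F' :=
  integral_mono (integrable_ev F) (integrable_ev F') h

lemma ex_nonneg {d : ℕ} {F : MvPolynomial (Fin d) ℝ} (h : ∀ x, 0 ≤ ev F x) : 0 ≤ ex F :=
  integral_nonneg h

@[simp] lemma ex_C {d : ℕ} (a : ℝ) : ex (C a : MvPolynomial (Fin d) ℝ) = a := by simp [ex_apply]

@[simp] lemma ex_one {d : ℕ} : ex (1 : MvPolynomial (Fin d) ℝ) = 1 := by simp [ex_apply]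

@[simp] lemma ex_C_mul {d : ℕ} (a : ℝ) (F : MvPolynomial (Fin d) ℝ) : ex (C a * F) = a * ex F := by
  rw [← MvPolynomial.smul_eq_C_mul, map_smul, smul_eq_mul]

lemma ex_monomial {d : ℕ} (s : Fin d →₀ ℕ) (a : ℝ) :
    ex (MvPolynomial.monomial s a) = a * ∏ i, gaussMoment (s i) := by
  rw [ex_apply, integral_gam_eq _ (continuous_ev _)]
  simp only [ev, MvPolynomial.eval_monomial, Finsupp.prod_fintype, pow_zero, implies_true]
  rw [integral_const_mul, integral_fintype_prod_eq_prod (𝕜 := ℝ)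
    (f := fun i (z : ℝ) => z ^ s i)]
  rfl

/-- Gaussian integration by parts for polynomials. -/
lemma ex_X_mul {d : ℕ} (c : Fin d) (F : MvPolynomial (Fin d) ℝ) :
    ex (X c * F) = ex (pderiv c F) := by
  induction F using MvPolynomial.induction_on' with
  | monomial s a =>
    rw [MvPolynomial.pderiv_monomial, MvPolynomial.X, MvPolynomial.monomial_mul, ex_monomial,
      ex_monomial, one_mul, mul_assoc]
    congr 1
    -- Only the factor of the coordinate `c` differs, and there the moment recursion applies.
    rw [← Finset.mul_prod_erase Finset.univ _ (Finset.mem_univ c),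
      ← Finset.mul_prod_erase Finset.univ (fun i => gaussMoment ((s - Finsupp.single c 1 : Fin d →₀ ℕ) i))
        (Finset.mem_univ c), ← mul_assoc]
    congr 1
    · simp [add_comm 1, gaussMoment_succ]
    · refine Finset.prod_congr rfl fun i hi => ?_
      have : c ≠ i := (Finset.ne_of_mem_erase hi).symm
      simp [Finsupp.single_eq_of_ne' this]
  | add p q hp hq => simp [mul_add, hp, hq]

/-! ### Creation operators, Wiener chaoses and their projections -/

section algebra

variable {d : ℕ}

/-- The commutator is again a derivation, so it is enough that it kills the variables. -/
lemma pderiv_comm (b c : Fin d) (F : MvPolynomial (Fin d) ℝ) :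
    pderiv b (pderiv c F) = pderiv c (pderiv b F) := by
  have h : ⁅(pderiv b : Derivation ℝ (MvPolynomial (Fin d) ℝ) (MvPolynomial (Fin d) ℝ)),
      (pderiv c : Derivation ℝ (MvPolynomial (Fin d) ℝ) (MvPolynomial (Fin d) ℝ))⁆ = 0 := by
    refine MvPolynomial.derivation_ext fun i => ?_
    rw [Derivation.commutator_apply]
    by_cases h1 : i = b <;> by_cases h2 : i = c <;>
      simp [MvPolynomial.pderiv_X, Pi.single_apply, h1, h2, apply_ite]
  have := congrArg (fun D : Derivation ℝ (MvPolynomial (Fin d) ℝ) (MvPolynomial (Fin d) ℝ) => D F) h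
  simpa [Derivation.commutator_apply, sub_eq_zero] using this

/-- The adjoint `F ↦ x_c F - ∂_c F` of `∂_c` with respect to the Gaussian inner product. -/
noncomputable def creation (c : Fin d) :
    MvPolynomial (Fin d) ℝ →ₗ[ℝ] MvPolynomial (Fin d) ℝ where
  toFun F := X c * F - pderiv c F
  map_add' F F' := by simp only [map_add]; ring
  map_smul' a F := by simp [smul_sub]

lemma creation_apply (c : Fin d) (F : MvPolynomial (Fin d) ℝ) :
    creation c F = X c * F - pderiv c F := rfl

lemma ex_mul_creation (c : Fin d) (F G : MvPolynomial (Fin d) ℝ) :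
    ex (F * creation c G) = ex (pderiv c F * G) := by
  have h : F * creation c G = X c * (F * G) - F * pderiv c G := by rw [creation_apply]; ring
  rw [h, map_sub, ex_X_mul, MvPolynomial.pderiv_mul, map_add]
  ring

lemma pderiv_creation (b c : Fin d) (F : MvPolynomial (Fin d) ℝ) :
    pderiv b (creation c F) = (if c = b then F else 0) + creation c (pderiv b F) := by
  simp only [creation_apply, map_sub, MvPolynomial.pderiv_mul, MvPolynomial.pderiv_X,
    pderiv_comm b c, Pi.single_apply]
  split_ifs
  · simp; ring
  · simp

lemma creation_comm (b c : Fin d) (F : MvPolynomial (Fin d) ℝ) :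
    creation b (creation c F) = creation c (creation b F) := by
  simp only [creation_apply, map_sub, MvPolynomial.pderiv_mul, MvPolynomial.pderiv_X,
    pderiv_comm b c, Pi.single_apply, eq_comm (a := b)]
  split_ifs with h
  · subst h; ring
  · ring

/-- The unnormalized multivariate Hermite polynomials, indexed by tuples of coordinates. -/
noncomputable def hermitePoly : (k : ℕ) → (Fin k → Fin d) → MvPolynomial (Fin d) ℝ
  | 0, _ => 1
  | k + 1, a => creation (a 0) (hermitePoly k (Fin.tail a))

lemma hermitePoly_zero (a : Fin 0 → Fin d) : hermitePoly 0 a = 1 := rfl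

lemma hermitePoly_succ (k : ℕ) (a : Fin (k + 1) → Fin d) :
    hermitePoly (k + 1) a = creation (a 0) (hermitePoly k (Fin.tail a)) := rfl

variable (d) in
/-- The `k`-th Wiener chaos: the span of the Hermite polynomials of degree `k`. -/
noncomputable def chaos (k : ℕ) : Submodule ℝ (MvPolynomial (Fin d) ℝ) :=
  Submodule.span ℝ (Set.range (hermitePoly k))

lemma hermitePoly_mem_chaos (k : ℕ) (a : Fin k → Fin d) : hermitePoly k a ∈ chaos d k :=
  Submodule.subset_span ⟨a, rfl⟩

lemma creation_mem_chaos (c : Fin d) {k : ℕ} {F : MvPolynomial (Fin d) ℝ} (hF : F ∈ chaos d k) :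
    creation c F ∈ chaos d (k + 1) := by
  induction hF using Submodule.span_induction with
  | mem x hx =>
    obtain ⟨a, rfl⟩ := hx
    have := hermitePoly_mem_chaos (k + 1) (Fin.cons c a)
    simpa [hermitePoly_succ] using this
  | zero => simp
  | add x y _ _ hx hy => rw [map_add]; exact add_mem hx hy
  | smul r x _ hx => rw [map_smul]; exact Submodule.smul_mem _ _ hx

lemma pderiv_chaos_zero (c : Fin d) {F : MvPolynomial (Fin d) ℝ} (hF : F ∈ chaos d 0) :
    pderiv c F = 0 := by
  induction hF using Submodule.span_induction with
  | mem x hx => obtain ⟨a, rfl⟩ := hx; simp [hermitePoly_zero]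
  | zero => simp
  | add x y _ _ hx hy => rw [map_add, hx, hy, add_zero]
  | smul r x _ hx => rw [Derivation.map_smul, hx, smul_zero]

lemma pderiv_mem_chaos (c : Fin d) {k : ℕ} {F : MvPolynomial (Fin d) ℝ}
    (hF : F ∈ chaos d (k + 1)) : pderiv c F ∈ chaos d k := by
  induction k generalizing F with
  | zero =>
    induction hF using Submodule.span_induction with
    | mem x hx =>
      obtain ⟨a, rfl⟩ := hx
      rw [hermitePoly_succ, pderiv_creation, hermitePoly_zero, MvPolynomial.pderiv_one, map_zero,
        add_zero]
      split_ifs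
      · exact hermitePoly_mem_chaos 0 (Fin.tail a)
      · exact zero_mem _
    | zero => simp
    | add x y _ _ hx hy => rw [map_add]; exact add_mem hx hy
    | smul r x _ hx => rw [Derivation.map_smul]; exact Submodule.smul_mem _ _ hx
  | succ k ih =>
    induction hF using Submodule.span_induction with
    | mem x hx =>
      obtain ⟨a, rfl⟩ := hx
      rw [hermitePoly_succ, pderiv_creation]
      refine add_mem ?_ (creation_mem_chaos _ (ih (hermitePoly_mem_chaos _ _)))
      split_ifs
      · exact hermitePoly_mem_chaos _ _
      · exact zero_mem _
    | zero => simp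
    | add x y _ _ hx hy => rw [map_add]; exact add_mem hx hy
    | smul r x _ hx => rw [Derivation.map_smul]; exact Submodule.smul_mem _ _ hx

/-- The chaoses are eigenspaces of the number operator. -/
lemma sum_creation_pderiv {k : ℕ} {F : MvPolynomial (Fin d) ℝ} (hF : F ∈ chaos d k) :
    ∑ c, creation c (pderiv c F) = (k : ℝ) • F := by
  induction k generalizing F with
  | zero => simp [pderiv_chaos_zero _ hF]
  | succ k ih =>
    induction hF using Submodule.span_induction with
    | mem x hx =>
      obtain ⟨a, rfl⟩ := hx
      simp only [hermitePoly_succ, pderiv_creation, map_add, Finset.sum_add_distrib,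
        creation_comm _ (a 0)]
      rw [← map_sum, ih (hermitePoly_mem_chaos _ _)]
      simp [apply_ite, add_smul, add_comm]
    | zero => simp
    | add x y _ _ hx hy => simp only [map_add, Finset.sum_add_distrib, hx, hy, smul_add]
    | smul r x _ hx => simp only [Derivation.map_smul, map_smul, ← Finset.smul_sum, hx, smul_comm r]

lemma ex_sum_pderiv_mul_pderiv {k : ℕ} (F : MvPolynomial (Fin d) ℝ) {G : MvPolynomial (Fin d) ℝ}
    (hG : G ∈ chaos d k) : ex (∑ c, pderiv c F * pderiv c G) = k * ex (F * G) := by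
  have h := congrArg (fun H => ex (F * H)) (sum_creation_pderiv hG)
  simp only [Finset.mul_sum, map_sum, ex_mul_creation, mul_smul_comm, map_smul, smul_eq_mul] at h
  rw [map_sum, h]

/-- The Dirichlet form is symmetric and equals both `j` and `k` times `𝔼[F G]`: eigenvectors of a
symmetric operator with distinct eigenvalues are orthogonal. -/
lemma ex_mul_eq_zero_of_ne {j k : ℕ} (hjk : j ≠ k) {F G : MvPolynomial (Fin d) ℝ}
    (hF : F ∈ chaos d j) (hG : G ∈ chaos d k) : ex (F * G) = 0 := by
  have h1 := ex_sum_pderiv_mul_pderiv F hG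
  have h2 := ex_sum_pderiv_mul_pderiv G hF
  simp only [mul_comm (pderiv _ G), mul_comm G F] at h2
  have h3 : ((j : ℝ) - k) * ex (F * G) = 0 := by linarith
  exact (mul_eq_zero.1 h3).resolve_left (sub_ne_zero.2 (Nat.cast_injective.ne hjk))

/-- `∑_a 𝔼[F H_a] H_a`, the sum being over the Hermite polynomials of degree `k`. -/
noncomputable def hermiteSum (k : ℕ) : MvPolynomial (Fin d) ℝ →ₗ[ℝ] MvPolynomial (Fin d) ℝ where
  toFun F := ∑ a : Fin k → Fin d, ex (F * hermitePoly k a) • hermitePoly k a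
  map_add' F G := by simp [add_mul, add_smul, Finset.sum_add_distrib]
  map_smul' r F := by simp [Finset.smul_sum, mul_smul]

lemma hermiteSum_apply (k : ℕ) (F : MvPolynomial (Fin d) ℝ) :
    hermiteSum k F = ∑ a : Fin k → Fin d, ex (F * hermitePoly k a) • hermitePoly k a := rfl

lemma hermiteSum_zero (F : MvPolynomial (Fin d) ℝ) : hermiteSum 0 F = C (ex F) := by
  simp [hermiteSum_apply, hermitePoly_zero, MvPolynomial.smul_eq_C_mul]

/-- Splitting off the first index and using adjointness of `creation` and `pderiv` gives a recursion
that reduces the projection to the number operator. -/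
lemma hermiteSum_succ (k : ℕ) (F : MvPolynomial (Fin d) ℝ) :
    hermiteSum (k + 1) F = ∑ c, creation c (hermiteSum k (pderiv c F)) := by
  rw [hermiteSum_apply, ← (Fin.consEquiv fun _ => Fin d).sum_comp, Fintype.sum_prod_type]
  refine Finset.sum_congr rfl fun c _ => ?_
  rw [hermiteSum_apply, map_sum]
  refine Finset.sum_congr rfl fun a _ => ?_
  simp [Fin.consEquiv, hermitePoly_succ, ex_mul_creation]

/-- The recursion meets the number operator once in each degree; its eigenvalues `k, k - 1, …, 1`
multiply to `k!`. -/
lemma hermiteSum_of_mem {k : ℕ} {F : MvPolynomial (Fin d) ℝ} (hF : F ∈ chaos d k) :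
    hermiteSum k F = (k.factorial : ℝ) • F := by
  induction k generalizing F with
  | zero =>
    rw [hermiteSum_zero]
    induction hF using Submodule.span_induction with
    | mem x hx => obtain ⟨a, rfl⟩ := hx; simp [hermitePoly_zero]
    | zero => simp
    | add x y _ _ hx hy => rw [map_add, map_add, hx, hy, smul_add]
    | smul r x _ hx => rw [map_smul, smul_comm, ← hx, smul_eq_mul, map_mul,
        MvPolynomial.smul_eq_C_mul]
  | succ k ih =>
    simp only [hermiteSum_succ, ih (pderiv_mem_chaos _ hF), map_smul, ← Finset.smul_sum,
      sum_creation_pderiv hF, smul_smul, Nat.factorial_succ]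
    push_cast
    rw [mul_comm]

/-- The orthogonal projection onto the `k`-th chaos. -/
noncomputable def chaosProj (k : ℕ) : MvPolynomial (Fin d) ℝ →ₗ[ℝ] MvPolynomial (Fin d) ℝ :=
  (k.factorial : ℝ)⁻¹ • hermiteSum k

lemma chaosProj_apply (k : ℕ) (F : MvPolynomial (Fin d) ℝ) : chaosProj k F =
    (k.factorial : ℝ)⁻¹ • ∑ a : Fin k → Fin d, ex (F * hermitePoly k a) • hermitePoly k a := rfl

lemma chaosProj_mem (k : ℕ) (F : MvPolynomial (Fin d) ℝ) : chaosProj k F ∈ chaos d k :=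
  by
  rw [chaosProj_apply]
  exact Submodule.smul_mem _ _ (Submodule.sum_mem _ fun a _ =>
    Submodule.smul_mem _ _ (hermitePoly_mem_chaos k a))

lemma chaosProj_of_mem {k : ℕ} {F : MvPolynomial (Fin d) ℝ} (hF : F ∈ chaos d k) :
    chaosProj k F = F := by
  rw [chaosProj, LinearMap.smul_apply, hermiteSum_of_mem hF, smul_smul, inv_mul_cancel₀, one_smul]
  positivity

lemma chaosProj_of_mem_of_ne {j k : ℕ} (hjk : k ≠ j) {F : MvPolynomial (Fin d) ℝ}
    (hF : F ∈ chaos d k) : chaosProj j F = 0 := by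
  simp [chaosProj_apply, ex_mul_eq_zero_of_ne hjk hF (hermitePoly_mem_chaos _ _)]

lemma chaosProj_zero (F : MvPolynomial (Fin d) ℝ) : chaosProj 0 F = C (ex F) := by
  simp [chaosProj, hermiteSum_zero]

lemma one_mem_chaos : (1 : MvPolynomial (Fin d) ℝ) ∈ chaos d 0 :=
  hermitePoly_mem_chaos 0 Fin.elim0

lemma ex_mul_chaosProj (k : ℕ) (F G : MvPolynomial (Fin d) ℝ) :
    ex (F * chaosProj k G) = ex (chaosProj k F * G) := by
  simp only [chaosProj_apply, mul_smul_comm, smul_mul_assoc, map_smul, Finset.mul_sum,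
    Finset.sum_mul, map_sum, smul_eq_mul]
  refine Finset.sum_congr rfl fun a _ => ?_
  rw [mul_comm (hermitePoly k a) G]
  ring

lemma ex_chaosProj_sq_le (k : ℕ) (F : MvPolynomial (Fin d) ℝ) :
    ex (chaosProj k F ^ 2) ≤ ex (F ^ 2) := by
  have h1 : ex (F * chaosProj k F) = ex (chaosProj k F ^ 2) := by
    rw [sq, ex_mul_chaosProj k (chaosProj k F) F, chaosProj_of_mem (chaosProj_mem k F),
      mul_comm]
  have h2 : 0 ≤ ex ((F - chaosProj k F) ^ 2) := ex_nonneg fun x => by simp; positivity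
  have h3 : (F - chaosProj k F) ^ 2
      = F ^ 2 - (F * chaosProj k F + F * chaosProj k F) + chaosProj k F ^ 2 := by ring
  rw [h3, map_add, map_sub, map_add, h1] at h2
  linarith

end algebra

/-! ### Identification with the analytic Hermite tensors -/

section tensor

variable {d : ℕ}

lemma hasFDerivAt_ev (F : MvPolynomial (Fin d) ℝ) (x : E d) :
    HasFDerivAt (ev F) (∑ c, ev (pderiv c F) x • (EuclideanSpace.proj c : E d →L[ℝ] ℝ)) x := by
  induction F using MvPolynomial.induction_on with
  | C a =>
    have : ev (C a : MvPolynomial (Fin d) ℝ) = fun _ => a := by ext; simp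
    rw [this]
    simpa using hasFDerivAt_const a x
  | add p q hp hq =>
    have : ev (p + q) = fun y => ev p y + ev q y := by ext; simp
    rw [this]
    refine (hp.add hq).congr_fderiv ?_
    simp [add_smul, Finset.sum_add_distrib]
  | mul_X p n hp =>
    have : ev (p * X n) = fun y => ev p y * (EuclideanSpace.proj n : E d →L[ℝ] ℝ) y := by
      ext; simp
    rw [this]
    refine (hp.mul (EuclideanSpace.proj n : E d →L[ℝ] ℝ).hasFDerivAt).congr_fderiv ?_
    have h1 : ∀ c, ev (pderiv c (p * X n)) x • (EuclideanSpace.proj c : E d →L[ℝ] ℝ)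
        = (if c = n then ev p x • (EuclideanSpace.proj c : E d →L[ℝ] ℝ) else 0)
          + x n • ev (pderiv c p) x • (EuclideanSpace.proj c : E d →L[ℝ] ℝ) := by
      intro c
      rw [MvPolynomial.pderiv_mul, MvPolynomial.pderiv_X, ev_add, ev_mul, ev_mul, ev_X, add_smul,
        smul_smul, mul_comm (x n), add_comm]
      congr 1
      split_ifs with h
      · subst h; simp
      · simp [Ne.symm h]
    simp only [h1, Finset.sum_add_distrib, ← Finset.smul_sum]
    simp

lemma fderiv_ev_single (F : MvPolynomial (Fin d) ℝ) (x : E d) (c : Fin d) :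
    fderiv ℝ (ev F) x (EuclideanSpace.single c 1) = ev (pderiv c F) x := by
  rw [(hasFDerivAt_ev F x).fderiv, sum_apply, Finset.sum_eq_single c]
  · simp
  · intro b _ hb; simp [hb]
  · simp

lemma contDiff_gaussDensity : ContDiff ℝ ⊤ (gaussDensity d) := by
  unfold gaussDensity
  exact ((contDiff_const.mul (contDiff_norm_sq ℝ)).exp).div_const _

lemma fderiv_gaussDensity_single (x : E d) (c : Fin d) :
    fderiv ℝ (gaussDensity d) x (EuclideanSpace.single c 1) = -(x c * gaussDensity d x) := by
  have h : HasFDerivAt (gaussDensity d) _ x :=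
    (((hasStrictFDerivAt_norm_sq x).hasFDerivAt.const_mul (-(1 / 2) : ℝ)).exp).mul_const
      ((2 * Real.pi) ^ ((d : ℝ) / 2))⁻¹
  rw [h.fderiv]
  simp [gaussDensity, EuclideanSpace.inner_single_right]
  ring

/-- Since `∂_c μ = -x_c μ`, differentiating `H μ` gives `-(x_c H - ∂_c H) μ`, that is, one creation
operator and one sign. -/
lemma iteratedFDeriv_gaussDensity (k : ℕ) (x : E d) (a : Fin k → Fin d) :
    iteratedFDeriv ℝ k (gaussDensity d) x (fun j => EuclideanSpace.single (a j) (1 : ℝ))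
      = (-1) ^ k * ev (hermitePoly k a) x * gaussDensity d x := by
  induction k generalizing x with
  | zero => simp [hermitePoly_zero]
  | succ k ih =>
    rw [DifferentiableAt.iteratedFDeriv_succ_apply_left'
      ((contDiff_gaussDensity.differentiable_iteratedFDeriv (m := k) (by simp)) x)]
    have h1 : (fun y => iteratedFDeriv ℝ k (gaussDensity d) y
        (Fin.tail fun j => EuclideanSpace.single (a j) (1 : ℝ)))
        = fun y => (-1) ^ k * (ev (hermitePoly k (Fin.tail a)) y * gaussDensity d y) := by
      ext y
      rw [← mul_assoc]
      exact ih y (Fin.tail a)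
    have hd1 := (hasFDerivAt_ev (hermitePoly k (Fin.tail a)) x).differentiableAt
    have hd2 := (contDiff_gaussDensity (d := d)).differentiable (by simp) x
    rw [h1, fderiv_const_mul (hd1.fun_mul hd2), fderiv_fun_mul hd1 hd2]
    simp [fderiv_gaussDensity_single, fderiv_ev_single, hermitePoly_succ, creation_apply]
    ring

lemma gaussDensity_pos (x : E d) : 0 < gaussDensity d x := by
  unfold gaussDensity; positivity

lemma hermiteTensor_eq (k : ℕ) (x : E d) (a : Fin k → Fin d) :
    hermiteTensor k x a = (Real.sqrt (k.factorial : ℝ))⁻¹ * ev (hermitePoly k a) x := by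
  rw [hermiteTensor, iteratedFDeriv_gaussDensity, mul_div_assoc, div_self (gaussDensity_pos x).ne',
    mul_one, div_mul_eq_mul_div, ← mul_assoc, ← mul_pow]
  simp [div_eq_inv_mul]

lemma hermiteProj_ev (k : ℕ) (F : MvPolynomial (Fin d) ℝ) (x : E d) :
    hermiteProj k (ev F) x = ev (chaosProj k F) x := by
  -- One factor `1/√k!` comes from the coefficient and one from the tensor.
  have h : (Real.sqrt (k.factorial : ℝ))⁻¹ * (Real.sqrt (k.factorial : ℝ))⁻¹
      = (k.factorial : ℝ)⁻¹ := by
    rw [← mul_inv, Real.mul_self_sqrt (by positivity)]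
  simp only [hermiteProj, hermiteCoeff, hermiteTensor_eq, chaosProj_apply, ev_smul, ev_sum,
    Finset.mul_sum, mul_left_comm _ (Real.sqrt _)⁻¹, integral_const_mul]
  refine Finset.sum_congr rfl fun a _ => ?_
  simp only [ex_apply, ev_mul]
  rw [← h]
  ring

/-- A function fixed by the projection is a polynomial in the `k`-th chaos. -/
lemma exists_chaos_of_hermiteProj_eq {k : ℕ} {f : E d → ℝ} (h : hermiteProj k f = f) :
    ∃ F ∈ chaos d k, ev F = f := by
  refine ⟨∑ a : Fin k → Fin d, (hermiteCoeff k f a * (Real.sqrt (k.factorial : ℝ))⁻¹) •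
    hermitePoly k a, Submodule.sum_mem _ fun a _ =>
    Submodule.smul_mem _ _ (hermitePoly_mem_chaos k a), ?_⟩
  conv_rhs => rw [← h]
  ext x
  simp [hermiteProj, hermiteTensor_eq, mul_assoc]

end tensor

/-! ### Independence and projections of products -/

section independence

variable {d : ℕ}

/-- The polynomials invariant under translation by the vectors of `V`. -/
noncomputable def invariantPoly (V : Submodule ℝ (E d)) :
    Subalgebra ℝ (MvPolynomial (Fin d) ℝ) where
  carrier := {F | ∀ w ∈ V, ∀ x, ev F (x + w) = ev F x}
  mul_mem' hF hG w hw x := by simp [hF w hw x, hG w hw x]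
  add_mem' hF hG w hw x := by simp [hF w hw x, hG w hw x]
  algebraMap_mem' r w _ x := by simp [MvPolynomial.algebraMap_eq]

lemma pderiv_mem_invariantPoly {V : Submodule ℝ (E d)} {F : MvPolynomial (Fin d) ℝ}
    (hF : F ∈ invariantPoly V) (c : Fin d) : pderiv c F ∈ invariantPoly V := by
  intro w hw x
  have h : (fun x => ev F (x + w)) = ev F := funext fun x => hF w hw x
  rw [← fderiv_ev_single, ← fderiv_ev_single, ← fderiv_comp_add_right, h]

/-- Polynomials depending on orthogonal sets of directions are independent. -/
lemma ex_mul_of_invariant {V : Submodule ℝ (E d)} {F G : MvPolynomial (Fin d) ℝ}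
    (hF : F ∈ invariantPoly Vᗮ) (hG : G ∈ invariantPoly V) : ex (F * G) = ex F * ex G := by
  have hsum (x : E d) : V.starProjection x + Vᗮ.starProjection x = x :=
    V.starProjection_add_starProjection_orthogonal x
  have hF' (x : E d) : ev F x = ev F (V.starProjection x) := by
    conv_lhs => rw [← hsum x]
    exact hF _ (Submodule.starProjection_apply_mem _ _) _
  have hG' (x : E d) : ev G x = ev G (Vᗮ.starProjection x) := by
    conv_lhs => rw [← hsum x, add_comm]
    exact hG _ (Submodule.starProjection_apply_mem _ _) _
  -- The two projections are jointly Gaussian, so vanishing covariance yields independence.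
  have hlaw : HasGaussianLaw (fun x : E d => (V.starProjection x, Vᗮ.starProjection x)) (gam d) :=
    (IsGaussian.hasGaussianLaw_id (μ := gam d)).map (V.starProjection.prod Vᗮ.starProjection)
  have hind : IndepFun (fun x : E d => V.starProjection x) (fun x => Vᗮ.starProjection x)
      (gam d) := by
    refine hlaw.indepFun_of_covariance_inner fun x y => ?_
    have h1 : (fun ω : E d => inner ℝ x (V.starProjection ω))
        = fun ω => inner ℝ (V.starProjection x) ω := by
      ext ω; exact (Submodule.inner_starProjection_left_eq_right V x ω).symm
    have h2 : (fun ω : E d => inner ℝ y (Vᗮ.starProjection ω))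
        = fun ω => inner ℝ (Vᗮ.starProjection y) ω := by
      ext ω; exact (Submodule.inner_starProjection_left_eq_right Vᗮ y ω).symm
    rw [h1, h2, ← covarianceBilin_apply_eq_cov IsGaussian.memLp_two_id, gam,
      covarianceBilin_stdGaussian]
    exact Submodule.inner_right_of_mem_orthogonal (Submodule.starProjection_apply_mem V x)
      (Submodule.starProjection_apply_mem Vᗮ y)
  have hind' := hind.comp (continuous_ev F).measurable (continuous_ev G).measurable
  have := hind'.integral_fun_mul_eq_mul_integral
    ((continuous_ev F).comp V.starProjection.continuous).aestronglyMeasurable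
    ((continuous_ev G).comp Vᗮ.starProjection.continuous).aestronglyMeasurable
  simp only [Function.comp_apply, ← hF', ← hG'] at this
  simpa [ex_apply] using this

/-- Each creation operator in the Hermite polynomial is moved onto `F G` as a derivative. When it
hits `G`, what remains is `F` paired with a Hermite polynomial of degree below `k`, which is zero by
orthogonality. So all derivatives fall on `F`. -/
lemma ex_mul_mul_hermitePoly {V : Submodule ℝ (E d)} {j k : ℕ} (hjk : j ≤ k)
    {F G : MvPolynomial (Fin d) ℝ} (hF : F ∈ invariantPoly Vᗮ) (hG : G ∈ invariantPoly V)
    (hFk : F ∈ chaos d k) (a : Fin j → Fin d) :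
    ex (F * G * hermitePoly j a) = ex (F * hermitePoly j a) * ex G := by
  induction j generalizing k F G with
  | zero => simpa [hermitePoly_zero] using ex_mul_of_invariant hF hG
  | succ j ih =>
    obtain ⟨k, rfl⟩ : ∃ k', k = k' + 1 := ⟨k - 1, by omega⟩
    rw [hermitePoly_succ, ex_mul_creation, ex_mul_creation, MvPolynomial.pderiv_mul, add_mul,
      map_add, ih (by omega) (pderiv_mem_invariantPoly hF _) hG (pderiv_mem_chaos _ hFk),
      ih (by omega) hF (pderiv_mem_invariantPoly hG _) hFk,
      ex_mul_eq_zero_of_ne (by omega) hFk (hermitePoly_mem_chaos _ _)]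
    ring

lemma chaosProj_mul {V : Submodule ℝ (E d)} {j k : ℕ} (hjk : j ≤ k)
    {F G : MvPolynomial (Fin d) ℝ} (hF : F ∈ invariantPoly Vᗮ) (hG : G ∈ invariantPoly V)
    (hFk : F ∈ chaos d k) : chaosProj j (F * G) = ex G • chaosProj j F := by
  simp only [chaosProj_apply, ex_mul_mul_hermitePoly hjk hF hG hFk, smul_comm (ex G),
    Finset.smul_sum (r := ex G), smul_smul]

end independence

/-! ### Equivalence of moments on a fixed chaos -/

section hypercontractivity

variable {d : ℕ}

/-- A form of Young's inequality whose coefficient `1/2` allows the power of `b` to be absorbed on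
the other side. -/
lemma mul_pow_le_half_add {K a b : ℝ} (hK : 0 ≤ K) (ha : 0 ≤ a) (hb : 0 ≤ b) (r : ℕ) :
    K * (a * b ^ r) ≤ b ^ (r + 1) / 2 + (2 * K * a) ^ (r + 1) := by
  have hKa : 0 ≤ K * a := mul_nonneg hK ha
  rcases le_total (2 * K * a) b with h | h
  · have h1 : K * a * b ^ r ≤ b / 2 * b ^ r := by gcongr; linarith
    have h2 : 0 ≤ (2 * K * a) ^ (r + 1) := by positivity
    rw [pow_succ b]
    linarith
  · have h1 : 2 * K * a * b ^ r ≤ 2 * K * a * (2 * K * a) ^ r := by gcongr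
    have h2 : 0 ≤ K * a * b ^ r := by positivity
    have h3 : 0 ≤ b ^ (r + 1) := by positivity
    rw [pow_succ' (2 * K * a)]
    linarith

/-- The energy identity for powers of `|T|²`, where `T` is a vector of polynomials in one chaos. -/
lemma ex_sum_sq_pow_succ {ι : Type*} [Fintype ι] {j : ℕ} {T : ι → MvPolynomial (Fin d) ℝ}
    (hT : ∀ i, T i ∈ chaos d j) (r : ℕ) :
    j * ex ((∑ i, T i ^ 2) ^ (r + 1))
      = ex ((∑ i, ∑ c, pderiv c (T i) ^ 2) * (∑ i, T i ^ 2) ^ r)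
        + 2 * r * ex ((∑ c, (∑ i, T i * pderiv c (T i)) ^ 2) * (∑ i, T i ^ 2) ^ (r - 1)) := by
  set b := ∑ i, T i ^ 2 with hb
  have hdb (c : Fin d) : pderiv c b = 2 * ∑ i, T i * pderiv c (T i) := by
    rw [hb, map_sum, Finset.mul_sum]
    refine Finset.sum_congr rfl fun i _ => ?_
    rw [sq, MvPolynomial.pderiv_mul]
    ring
  have h1 : b ^ (r + 1) = ∑ i, T i * b ^ r * T i := by
    rw [pow_succ', hb, Finset.sum_mul]
    exact Finset.sum_congr rfl fun i _ => by ring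
  rw [h1, map_sum, Finset.mul_sum]
  simp only [← ex_sum_pderiv_mul_pderiv _ (hT _), ← map_sum]
  have h2 (i : ι) (c : Fin d) : pderiv c (T i * b ^ r) * pderiv c (T i)
      = pderiv c (T i) ^ 2 * b ^ r
        + C (2 * r : ℝ) * ((T i * pderiv c (T i)) * (∑ i, T i * pderiv c (T i)) * b ^ (r - 1)) := by
    rw [MvPolynomial.pderiv_mul, MvPolynomial.pderiv_pow, hdb]
    simp only [map_mul, map_natCast, map_ofNat]
    ring
  simp only [h2, Finset.sum_add_distrib, map_add, Finset.sum_mul, ← Finset.mul_sum, ex_C_mul]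
  congr 3
  rw [Finset.sum_comm]
  refine Finset.sum_congr rfl fun c _ => ?_
  rw [sq, ← Finset.sum_mul, ← Finset.sum_mul]

lemma ev_sum_sq_nonneg {ι : Type*} [Fintype ι] (T : ι → MvPolynomial (Fin d) ℝ) (x : E d) :
    0 ≤ ev (∑ i, T i ^ 2) x := by
  rw [ev_sum]
  exact Finset.sum_nonneg fun i _ => by rw [ev_pow]; positivity

/-- With `b = |T|²` and `a = |∇T|²`, Cauchy–Schwarz bounds the energy identity by `(1 + 2r) 𝔼[a
b^r]`, and Young's inequality absorbs the power of `b`. -/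
lemma ex_sum_sq_pow_succ_le_gradient {ι : Type*} [Fintype ι] {j : ℕ}
    {T : ι → MvPolynomial (Fin d) ℝ} (hT : ∀ i, T i ∈ chaos d (j + 1)) (r : ℕ) :
    ex ((∑ i, T i ^ 2) ^ (r + 1))
      ≤ 2 * (2 * (1 + 2 * r)) ^ (r + 1) * ex ((∑ i, ∑ c, pderiv c (T i) ^ 2) ^ (r + 1)) := by
  set a := ∑ i, ∑ c, pderiv c (T i) ^ 2 with ha
  set b := ∑ i, T i ^ 2 with hb
  have ha0 (x : E d) : 0 ≤ ev a x := by
    rw [ha, ← Fintype.sum_prod_type']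
    exact ev_sum_sq_nonneg (fun ic : ι × Fin d => pderiv ic.2 (T ic.1)) x
  have hb0 (x : E d) : 0 ≤ ev b x := ev_sum_sq_nonneg T x
  have hcs (x : E d) : ev (∑ c, (∑ i, T i * pderiv c (T i)) ^ 2) x ≤ ev (a * b) x := by
    rw [ha, Finset.sum_comm, ev_sum, Finset.sum_mul, ev_sum]
    refine Finset.sum_le_sum fun c _ => ?_
    have := Finset.sum_mul_sq_le_sq_mul_sq Finset.univ (fun i => ev (T i) x)
      (fun i => ev (pderiv c (T i)) x)
    simpa [hb, mul_comm] using this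
  have h1 : (r : ℝ) * ex ((∑ c, (∑ i, T i * pderiv c (T i)) ^ 2) * b ^ (r - 1))
      ≤ r * ex (a * b ^ r) := by
    -- At `r = 0` the truncated exponent `r - 1` does not matter, because the prefactor `r`
    -- vanishes.
    rcases r with _ | r
    · simp
    · refine mul_le_mul_of_nonneg_left (ex_mono fun x => ?_) (by positivity)
      rw [ev_mul, ev_mul, ev_pow, ev_pow, Nat.add_sub_cancel, pow_succ', ← mul_assoc]
      exact mul_le_mul_of_nonneg_right (by simpa using hcs x) (pow_nonneg (hb0 x) _)
  have h2 := ex_sum_sq_pow_succ hT r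
  rw [← ha, ← hb] at h2
  -- The eigenvalue `j + 1` is only used through `j + 1 ≥ 1`.
  have h3 : ex (b ^ (r + 1)) ≤ ((j + 1 : ℕ) : ℝ) * ex (b ^ (r + 1)) := by
    have : 0 ≤ ex (b ^ (r + 1)) := ex_nonneg fun x => by rw [ev_pow]; exact pow_nonneg (hb0 x) _
    push_cast
    nlinarith [mul_nonneg (Nat.cast_nonneg (α := ℝ) j) this]
  have h4 : ex (C (1 + 2 * r : ℝ) * (a * b ^ r))
      ≤ ex (C (1 / 2 : ℝ) * b ^ (r + 1) + C ((2 * (1 + 2 * r : ℝ)) ^ (r + 1)) * a ^ (r + 1)) := by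
    refine ex_mono fun x => ?_
    have := mul_pow_le_half_add (K := 1 + 2 * r) (by positivity) (ha0 x) (hb0 x) r
    simp only [ev_mul, ev_C, ev_pow, ev_add]
    rw [mul_pow] at this
    linarith
  rw [map_add ex, ex_C_mul, ex_C_mul, ex_C_mul] at h4
  linarith

/-- Passing to the gradient lowers the chaos by one at the price of more components, so the
induction is on vectors of arbitrary length with a constant independent of that length and of `d`.
In the end the elements of the chaos of degree zero are constants. -/
lemma ex_sum_sq_pow_le (j r : ℕ) : ∃ K : ℝ, 0 ≤ K ∧
    ∀ (d : ℕ) (ι : Type) [Fintype ι] (T : ι → MvPolynomial (Fin d) ℝ), (∀ i, T i ∈ chaos d j) →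
      ex ((∑ i, T i ^ 2) ^ (r + 1)) ≤ K * ex (∑ i, T i ^ 2) ^ (r + 1) := by
  induction j with
  | zero =>
    refine ⟨1, zero_le_one, fun d ι _ T hT => ?_⟩
    have h (i : ι) : T i = C (ex (T i)) := by
      rw [← chaosProj_zero, chaosProj_of_mem (hT i)]
    have h' : (∑ i, T i ^ 2) = C (∑ i, ex (T i) ^ 2) := by
      rw [map_sum]
      exact Finset.sum_congr rfl fun i _ => by rw [map_pow, ← h i]
    rw [h', ← map_pow, ex_C, ex_C, one_mul]
  | succ j ih =>
    obtain ⟨K, hK, ih⟩ := ih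
    refine ⟨2 * (2 * (1 + 2 * (r : ℝ))) ^ (r + 1) * (K * ((j : ℝ) + 1) ^ (r + 1)), by positivity,
      fun d ι _ T hT => ?_⟩
    refine (ex_sum_sq_pow_succ_le_gradient hT r).trans ?_
    rw [mul_assoc _ (K * _)]
    refine mul_le_mul_of_nonneg_left ?_ (by positivity)
    have h := ih d (ι × Fin d) (fun ic => pderiv ic.2 (T ic.1))
      fun ic => pderiv_mem_chaos _ (hT ic.1)
    rw [Fintype.sum_prod_type] at h
    refine h.trans (le_of_eq ?_)
    have h2 : ex (∑ i, ∑ c, pderiv c (T i) ^ 2) = (j + 1) * ex (∑ i, T i ^ 2) := by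
      rw [map_sum, map_sum, Finset.mul_sum]
      refine Finset.sum_congr rfl fun i _ => ?_
      have := ex_sum_pderiv_mul_pderiv (T i) (hT i)
      simpa [sq] using this
    rw [h2, mul_pow]
    ring

/-- Equivalence of moments on a fixed chaos. -/
lemma exists_ex_pow_le (k r : ℕ) : ∃ K : ℝ, 0 ≤ K ∧
    ∀ (d : ℕ) (F : MvPolynomial (Fin d) ℝ), F ∈ chaos d k →
      ex (F ^ (2 * (r + 1))) ≤ K * ex (F ^ 2) ^ (r + 1) := by
  obtain ⟨K, hK, h⟩ := ex_sum_sq_pow_le k r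
  refine ⟨K, hK, fun d F hF => ?_⟩
  simpa [pow_mul] using h d Unit (fun _ => F) fun _ => hF

end hypercontractivity

/-! ### Families with uniformly bounded moments -/

section moments

/-- All even moments of the polynomials of a family, possibly in different dimensions, are bounded
uniformly over the family. -/
def BddMoments {ι : Type} {d : ι → ℕ} (f : ∀ x, MvPolynomial (Fin (d x)) ℝ) : Prop :=
  ∀ r : ℕ, ∃ K : ℝ, ∀ x, ex (f x ^ (2 * r)) ≤ K

variable {ι : Type} {d : ι → ℕ} {f g : ∀ x, MvPolynomial (Fin (d x)) ℝ}

lemma BddMoments.mul (hf : BddMoments f) (hg : BddMoments g) : BddMoments fun x => f x * g x := by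
  intro r
  obtain ⟨K, hK⟩ := hf (2 * r)
  obtain ⟨K', hK'⟩ := hg (2 * r)
  refine ⟨K + K', fun x => le_trans (ex_mono (F' := f x ^ (2 * (2 * r)) + g x ^ (2 * (2 * r)))
    fun y => ?_) (by rw [map_add]; exact add_le_add (hK x) (hK' x))⟩
  simp only [ev_pow, ev_mul, ev_add, mul_pow, mul_comm 2 (2 * r), pow_mul _ (2 * r) 2]
  nlinarith [sq_nonneg (ev (f x) y ^ (2 * r) - ev (g x) y ^ (2 * r)),
    sq_nonneg (ev (f x) y ^ (2 * r)), sq_nonneg (ev (g x) y ^ (2 * r))]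

lemma BddMoments.add (hf : BddMoments f) (hg : BddMoments g) : BddMoments fun x => f x + g x := by
  intro r
  obtain ⟨K, hK⟩ := hf r
  obtain ⟨K', hK'⟩ := hg r
  refine ⟨2 ^ (2 * r - 1) * (K + K'), fun x => le_trans
    (ex_mono (F' := C (2 ^ (2 * r - 1) : ℝ) * (f x ^ (2 * r) + g x ^ (2 * r))) fun y => ?_) ?_⟩
  · simp only [ev_pow, ev_mul, ev_add, ev_C]
    have h := add_pow_le (abs_nonneg (ev (f x) y)) (abs_nonneg (ev (g x) y)) (2 * r)
    have hev : Even (2 * r) := even_two_mul r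
    rw [hev.pow_abs, hev.pow_abs] at h
    refine le_trans ?_ h
    rw [← hev.pow_abs (ev (f x) y + ev (g x) y)]
    exact pow_le_pow_left₀ (abs_nonneg _) (abs_add_le _ _) _
  · rw [ex_C_mul, map_add]
    exact mul_le_mul_of_nonneg_left (add_le_add (hK x) (hK' x)) (by positivity)

lemma bddMoments_C {a : ι → ℝ} {M : ℝ} (ha : ∀ x, |a x| ≤ M) :
    BddMoments fun x => (C (a x) : MvPolynomial (Fin (d x)) ℝ) := by
  refine fun r => ⟨M ^ (2 * r), fun x => ?_⟩
  rw [← map_pow, ex_C, ← (even_two_mul r).pow_abs]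
  exact pow_le_pow_left₀ (abs_nonneg _) (ha x) _

lemma BddMoments.const_mul (a : ℝ) (hf : BddMoments f) : BddMoments fun x => C a * f x :=
  (bddMoments_C (d := d) (a := fun _ => a) fun _ => le_rfl).mul hf

lemma BddMoments.sub (hf : BddMoments f) (hg : BddMoments g) : BddMoments fun x => f x - g x := by
  simpa [sub_eq_add_neg] using hf.add (hg.const_mul (-1))

lemma BddMoments.pow (hf : BddMoments f) (n : ℕ) : BddMoments fun x => f x ^ n := by
  induction n with
  | zero => simpa using bddMoments_C (d := d) (a := fun _ => 1) fun _ => le_rfl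
  | succ n ih => simpa only [pow_succ] using ih.mul hf

lemma BddMoments.comp {ι' : Type} (hf : BddMoments f) (φ : ι' → ι) :
    BddMoments fun x => f (φ x) := fun r => by
  obtain ⟨K, hK⟩ := hf r
  exact ⟨K, fun x => hK (φ x)⟩

lemma BddMoments.exists_ex_sq_le (hf : BddMoments f) : ∃ K : ℝ, 0 ≤ K ∧ ∀ x, ex (f x ^ 2) ≤ K := by
  obtain ⟨K, hK⟩ := hf 1
  exact ⟨max K 0, le_max_right _ _, fun x => (hK x).trans (le_max_left _ _)⟩

/-- This is where dimension-free control of all moments enters: on a fixed chaos the second moment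
determines the scale of the others. -/
lemma bddMoments_of_mem_chaos {k : ℕ} (hf : ∀ x, f x ∈ chaos (d x) k)
    (h : ∀ x, ex (f x ^ 2) = 1) : BddMoments f := by
  rintro (_ | r)
  · exact ⟨1, fun x => by simp⟩
  · obtain ⟨K, _, hK⟩ := exists_ex_pow_le k r
    exact ⟨K, fun x => by simpa [h x] using hK _ (f x) (hf x)⟩

end moments

/-! ### Elementary moment inequalities -/

section elementary

variable {d : ℕ}

lemma ex_sq_nonneg (F : MvPolynomial (Fin d) ℝ) : 0 ≤ ex (F ^ 2) :=
  ex_nonneg fun x => by rw [ev_pow]; positivity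

/-- Contraction of the projection onto the constants. -/
lemma sq_ex_le (F : MvPolynomial (Fin d) ℝ) : ex F ^ 2 ≤ ex (F ^ 2) := by
  have h := ex_chaosProj_sq_le 0 F
  rwa [chaosProj_zero, ← map_pow, ex_C] at h

lemma ex_add_sq_le (F G : MvPolynomial (Fin d) ℝ) :
    ex ((F + G) ^ 2) ≤ 2 * ex (F ^ 2) + 2 * ex (G ^ 2) := by
  rw [← ex_C_mul, ← ex_C_mul, ← map_add]
  refine ex_mono fun x => ?_
  simp only [ev_pow, ev_add, ev_mul, ev_C]
  nlinarith [sq_nonneg (ev F x - ev G x)]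

lemma ex_sum_sq_le_card_mul {ι : Type*} (s : Finset ι) (F : ι → MvPolynomial (Fin d) ℝ) :
    ex ((∑ i ∈ s, F i) ^ 2) ≤ s.card * ∑ i ∈ s, ex (F i ^ 2) := by
  rw [← map_sum, ← ex_C_mul]
  refine ex_mono fun x => ?_
  simp only [ev_pow, ev_sum, ev_mul, ev_C]
  exact sq_sum_le_card_mul_sum_sq

/-- Fourth moment bound for sums of independent centered polynomials. -/
lemma ex_sum_pow_four_le {ι : Type*} [DecidableEq ι] (V : ι → Submodule ℝ (E d))
    (η : ι → MvPolynomial (Fin d) ℝ) {M : ℝ} (hM : 0 ≤ M) (h0 : ∀ i, ex (η i) = 0)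
    (h2 : ∀ i, ex (η i ^ 2) ≤ M) (h4 : ∀ i, ex (η i ^ 4) ≤ M)
    (hV : ∀ i, η i ∈ invariantPoly (V i)ᗮ) (hV' : ∀ i j, i ≠ j → η j ∈ invariantPoly (V i))
    (s : Finset ι) :
    ex (∑ i ∈ s, η i) = 0 ∧ ex ((∑ i ∈ s, η i) ^ 2) ≤ M * s.card ∧
      ex ((∑ i ∈ s, η i) ^ 4) ≤ (3 * M ^ 2 + M) * s.card ^ 2 := by
  induction s using Finset.induction_on with
  | empty => simp
  | insert i s hi ih =>
    obtain ⟨ih0, ih2, ih4⟩ := ih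
    rw [Finset.sum_insert hi, Finset.card_insert_of_notMem hi]
    set S := ∑ j ∈ s, η j with hS
    have hSV : S ∈ invariantPoly (V i) :=
      sum_mem fun j hj => hV' i j fun h => hi (h ▸ hj)
    have hind (a b : ℕ) : ex (η i ^ a * S ^ b) = ex (η i ^ a) * ex (S ^ b) :=
      ex_mul_of_invariant (pow_mem (hV i) a) (pow_mem hSV b)
    have e11 : ex (η i * S) = 0 := by simpa [h0] using hind 1 1
    have e13 : ex (η i * S ^ 3) = 0 := by simpa [h0] using hind 1 3
    have e31 : ex (η i ^ 3 * S) = 0 := by simpa [ih0] using hind 3 1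
    have h2' := ex_sq_nonneg (η i)
    have hS2 := ex_sq_nonneg S
    refine ⟨by rw [map_add, h0, ih0, add_zero], ?_, ?_⟩
    · have : (η i + S) ^ 2 = η i ^ 2 + C 2 * (η i * S) + S ^ 2 := by rw [map_ofNat]; ring
      rw [this, map_add, map_add, ex_C_mul, e11]
      push_cast
      linarith [h2 i]
    · have : (η i + S) ^ 4 = η i ^ 4 + C 4 * (η i ^ 3 * S) + C 6 * (η i ^ 2 * S ^ 2)
          + C 4 * (η i * S ^ 3) + S ^ 4 := by simp only [map_ofNat]; ring
      rw [this, map_add, map_add, map_add, map_add, ex_C_mul, ex_C_mul, ex_C_mul, e31, e13,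
        hind 2 2]
      -- The terms with a single `η i` or a single `S` vanish. With `n = s.card`, the cross term `6
      -- M² n` is paid for by `3 M² ((n + 1)² - n²)`, and the new fourth moment by `M ((n + 1)² -
      -- n²)`.
      have h6 : ex (η i ^ 2) * ex (S ^ 2) ≤ M * (M * s.card) :=
        mul_le_mul (h2 i) ih2 hS2 hM
      have hc : (0 : ℝ) ≤ s.card := by positivity
      push_cast
      nlinarith [h4 i, mul_nonneg hM hc, sq_nonneg M]

end elementary

/-! ### Expansion of powers to second order -/

section expansion

variable {A : Type*} [CommRing A]

/-- The second order remainder in the expansion of `(p - e)^n` around `p`. -/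
def powRemainder (p e : A) : ℕ → A
  | 0 => 0
  | n + 1 => n * p ^ (n - 1) + (p - e) * powRemainder p e n

/-- The remainder is an explicit polynomial defined by recursion, so that its moments can be bounded
along the same recursion. -/
lemma sub_pow_eq_powRemainder (p e : A) (n : ℕ) :
    (p - e) ^ n = p ^ n - n * e * p ^ (n - 1) + e ^ 2 * powRemainder p e n := by
  induction n with
  | zero => simp [powRemainder]
  | succ n ih =>
    have h : (n : A) * p ^ n = n * (p * p ^ (n - 1)) := by
      cases n with
      | zero => simp
      | succ n => rw [Nat.add_sub_cancel, pow_succ']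
    rw [pow_succ', ih, powRemainder, Nat.add_sub_cancel]
    push_cast
    linear_combination e * h

end expansion

/-! ### Powers of a normalized sum of independent chaos elements -/

/-- A normalized sum of independent polynomials in the `k`-th chaos. -/
structure ChaosSum (k : ℕ) (B : ℝ) where
  /-- the dimension -/
  d : ℕ
  /-- the number of summands -/
  L : ℕ
  /-- the weights -/
  lam : Fin L → ℝ
  /-- the summands -/
  psi : Fin L → MvPolynomial (Fin d) ℝ
  /-- the directions on which a summand depends -/
  V : Fin L → Submodule ℝ (E d)
  L_pos : 0 < L
  psi_mem : ∀ i, psi i ∈ chaos d k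
  psi_inv : ∀ i, psi i ∈ invariantPoly (V i)ᗮ
  psi_inv_of_ne : ∀ i j, i ≠ j → psi j ∈ invariantPoly (V i)
  psi_sq : ∀ i, ex (psi i ^ 2) = 1
  abs_lam_le : ∀ i, |lam i| ≤ B
  sum_sq : ex ((∑ i, C (lam i / Real.sqrt L) * psi i) ^ 2) = 1

namespace ChaosSum

variable {k : ℕ} {B : ℝ}

/-- The weighted and normalized summand. -/
noncomputable def eps (D : ChaosSum k B) (i : Fin D.L) : MvPolynomial (Fin D.d) ℝ :=
  C (D.lam i / Real.sqrt D.L) * D.psi i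

/-- The sum. -/
noncomputable def p (D : ChaosSum k B) : MvPolynomial (Fin D.d) ℝ := ∑ i, D.eps i

lemma eps_mem (D : ChaosSum k B) (i : Fin D.L) : D.eps i ∈ chaos D.d k := by
  rw [eps, ← MvPolynomial.smul_eq_C_mul]
  exact Submodule.smul_mem _ _ (D.psi_mem i)

lemma p_mem (D : ChaosSum k B) : D.p ∈ chaos D.d k := Submodule.sum_mem _ fun i _ => D.eps_mem i

lemma ex_p_sq (D : ChaosSum k B) : ex (D.p ^ 2) = 1 := D.sum_sq

lemma eps_inv (D : ChaosSum k B) (i : Fin D.L) : D.eps i ∈ invariantPoly (D.V i)ᗮ :=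
  mul_mem (Subalgebra.algebraMap_mem _ _) (D.psi_inv i)

lemma eps_inv_of_ne (D : ChaosSum k B) {i j : Fin D.L} (h : i ≠ j) :
    D.eps j ∈ invariantPoly (D.V i) :=
  mul_mem (Subalgebra.algebraMap_mem _ _) (D.psi_inv_of_ne i j h)

lemma p_sub_eps_inv (D : ChaosSum k B) (i : Fin D.L) : D.p - D.eps i ∈ invariantPoly (D.V i) := by
  classical
  rw [p, ← Finset.add_sum_erase _ _ (Finset.mem_univ i), add_sub_cancel_left]
  exact sum_mem fun j hj => D.eps_inv_of_ne (Finset.ne_of_mem_erase hj).symm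

lemma ex_eq_zero (hk : k ≠ 0) {d : ℕ} {F : MvPolynomial (Fin d) ℝ} (hF : F ∈ chaos d k) :
    ex F = 0 := by
  simpa using ex_mul_eq_zero_of_ne hk hF one_mem_chaos

/-- The summands are independent and centered, so the cross terms vanish. -/
lemma ex_sum_C_mul_eps_sq (hk : k ≠ 0) (D : ChaosSum k B) (b : Fin D.L → ℝ) :
    ex ((∑ i, C (b i) * D.eps i) ^ 2) = (∑ i, b i ^ 2 * D.lam i ^ 2) / D.L := by
  rw [sq, Finset.sum_mul_sum, map_sum, Finset.sum_div]
  refine Finset.sum_congr rfl fun i _ => ?_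
  rw [map_sum, Finset.sum_eq_single i]
  · have : C (b i) * D.eps i * (C (b i) * D.eps i)
        = C (b i ^ 2 * (D.lam i / Real.sqrt D.L) ^ 2) * D.psi i ^ 2 := by
      rw [eps]; simp only [map_mul, map_pow]; ring
    rw [this, ex_C_mul, D.psi_sq, div_pow, Real.sq_sqrt (by positivity)]
    ring
  · intro j _ hj
    rw [ex_mul_of_invariant (V := D.V i)]
    · rw [ex_C_mul, ex_C_mul, ex_eq_zero hk (D.eps_mem i)]; ring
    · exact mul_mem (Subalgebra.algebraMap_mem _ _) (D.eps_inv i)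
    · exact mul_mem (Subalgebra.algebraMap_mem _ _) (D.eps_inv_of_ne hj.symm)
  · simp

lemma L_pos' (D : ChaosSum k B) : (0 : ℝ) < D.L := Nat.cast_pos.2 D.L_pos

lemma sum_lam_sq (hk : k ≠ 0) (D : ChaosSum k B) : ∑ i, D.lam i ^ 2 = D.L := by
  have h := ex_sum_C_mul_eps_sq hk D fun _ => 1
  simp only [map_one, one_mul, one_pow] at h
  rw [← p, D.ex_p_sq, eq_div_iff D.L_pos'.ne', one_mul] at h
  exact h.symm

lemma bddMoments_psi :
    BddMoments fun x : (D : ChaosSum k B) × Fin D.L => x.1.psi x.2 :=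
  bddMoments_of_mem_chaos (fun x => x.1.psi_mem x.2) fun x => x.1.psi_sq x.2

lemma bddMoments_p : BddMoments fun D : ChaosSum k B => D.p :=
  bddMoments_of_mem_chaos p_mem ex_p_sq

lemma bddMoments_lam : BddMoments fun x : (D : ChaosSum k B) × Fin D.L =>
    (C (x.1.lam x.2) : MvPolynomial (Fin x.1.d) ℝ) :=
  bddMoments_C (d := fun x : (D : ChaosSum k B) × Fin D.L => x.1.d) fun x => x.1.abs_lam_le x.2

lemma bddMoments_lam_mul_psi : BddMoments fun x : (D : ChaosSum k B) × Fin D.L =>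
    C (x.1.lam x.2) * x.1.psi x.2 := bddMoments_lam.mul bddMoments_psi

lemma eps_eq (D : ChaosSum k B) (i : Fin D.L) :
    D.eps i = C (1 / Real.sqrt D.L) * (C (D.lam i) * D.psi i) := by
  rw [eps, ← mul_assoc, ← map_mul]
  congr 2
  ring

lemma one_div_sqrt_sq (D : ChaosSum k B) : (1 / Real.sqrt D.L) ^ 2 = 1 / (D.L : ℝ) := by
  rw [div_pow, Real.sq_sqrt (by positivity), one_pow]

/-- Only `1/√L ≤ 1` is used; where the decay in `L` is needed, `eps_eq` extracts it explicitly. -/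
lemma bddMoments_eps : BddMoments fun x : (D : ChaosSum k B) × Fin D.L => x.1.eps x.2 := by
  simp only [eps_eq]
  refine (bddMoments_C (d := fun x : (D : ChaosSum k B) × Fin D.L => x.1.d) (M := 1)
    fun x => ?_).mul bddMoments_lam_mul_psi
  have h : (1 : ℝ) ≤ x.1.L := by exact_mod_cast x.1.L_pos
  rw [abs_of_nonneg (by positivity), div_le_one (by positivity)]
  exact Real.one_le_sqrt.2 h

lemma bddMoments_powRemainder (n : ℕ) : BddMoments fun x : (D : ChaosSum k B) × Fin D.L =>
    powRemainder x.1.p (x.1.eps x.2) n := by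
  have hp := (bddMoments_p (k := k) (B := B)).comp fun x : (D : ChaosSum k B) × Fin D.L => x.1
  induction n with
  | zero =>
    simpa [powRemainder] using bddMoments_C (d := fun x : (D : ChaosSum k B) × Fin D.L => x.1.d)
      (a := fun _ => 0) fun _ => le_rfl
  | succ n ih =>
    have := ((hp.pow (n - 1)).const_mul n).add ((hp.sub bddMoments_eps).mul ih)
    simpa only [powRemainder, map_natCast] using this

/-- The family of polynomials has `L²(γ)` norm `O(L^{-1/2})`. -/
def Small (F : ∀ D : ChaosSum k B, MvPolynomial (Fin D.d) ℝ) : Prop :=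
  ∃ K : ℝ, 0 ≤ K ∧ ∀ D, ex (F D ^ 2) ≤ K / D.L

section Small

variable {F G : ∀ D : ChaosSum k B, MvPolynomial (Fin D.d) ℝ}

lemma Small.add (hF : Small F) (hG : Small G) : Small fun D => F D + G D := by
  obtain ⟨K, hK, h⟩ := hF
  obtain ⟨K', hK', h'⟩ := hG
  refine ⟨2 * K + 2 * K', by positivity, fun D => (ex_add_sq_le _ _).trans ?_⟩
  have h1 := h D
  have h2 := h' D
  have h3 : (2 * K + 2 * K') / (D.L : ℝ) = 2 * (K / D.L) + 2 * (K' / D.L) := by ring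
  linarith

lemma Small.const_mul (hF : Small F) (a : ℝ) : Small fun D => C a * F D := by
  obtain ⟨K, hK, h⟩ := hF
  refine ⟨a ^ 2 * K, by positivity, fun D => ?_⟩
  rw [mul_pow, ← map_pow, ex_C_mul, mul_div_assoc]
  exact mul_le_mul_of_nonneg_left (h D) (sq_nonneg a)

lemma Small.chaosProj (hF : Small F) (j : ℕ) : Small fun D => chaosProj j (F D) := by
  obtain ⟨K, hK, h⟩ := hF
  exact ⟨K, hK, fun D => (ex_chaosProj_sq_le _ _).trans (h D)⟩

lemma small_zero : Small fun D : ChaosSum k B => (0 : MvPolynomial (Fin D.d) ℝ) :=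
  ⟨0, le_rfl, fun D => by simp⟩

end Small

/-- The fluctuation of `∑ ε_i²` around its mean. -/
noncomputable def sqFluctuation (D : ChaosSum k B) : MvPolynomial (Fin D.d) ℝ :=
  ∑ i, D.eps i ^ 2 - 1

/-- The normalization `∑ λ_i² = L` turns the fluctuation into an average of independent centered
terms. -/
lemma sqFluctuation_eq (hk : k ≠ 0) (D : ChaosSum k B) : D.sqFluctuation =
    C (1 / (D.L : ℝ)) * ∑ i, C (D.lam i ^ 2) * (D.psi i ^ 2 - 1) := by
  have h : C (1 / (D.L : ℝ)) * ∑ i, (C (D.lam i ^ 2) : MvPolynomial (Fin D.d) ℝ) = 1 := by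
    rw [← map_sum, D.sum_lam_sq hk, ← map_mul, one_div_mul_cancel D.L_pos'.ne', map_one]
  simp only [mul_sub, Finset.sum_sub_distrib, mul_one]
  rw [h, sqFluctuation, Finset.mul_sum]
  refine congrArg (· - 1) (Finset.sum_congr rfl fun i _ => ?_)
  rw [eps_eq, mul_pow, ← map_pow, one_div_sqrt_sq, mul_pow, map_pow]

/-- The factor `L^{-4}` meets the fourth moment `O(L²)` of a sum of `L` independent centered terms.
A fourth moment is needed because the fluctuation is later multiplied by `p^n` in `L²`. -/
lemma exists_ex_sqFluctuation_pow_four_le (hk : k ≠ 0) :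
    ∃ K : ℝ, 0 ≤ K ∧ ∀ D : ChaosSum k B, ex (D.sqFluctuation ^ 4) ≤ K / D.L ^ 2 := by
  classical
  have hη : BddMoments fun x : (D : ChaosSum k B) × Fin D.L =>
      C (x.1.lam x.2 ^ 2) * (x.1.psi x.2 ^ 2 - 1) := by
    have h1 := bddMoments_C (d := fun x : (D : ChaosSum k B) × Fin D.L => x.1.d)
      (a := fun _ => 1) fun _ => le_rfl
    have := (bddMoments_lam.pow 2).mul
      (((bddMoments_psi (k := k) (B := B)).pow 2).sub h1)
    simpa only [map_pow, map_one] using this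
  obtain ⟨K2, h2⟩ := hη 1
  obtain ⟨K4, h4⟩ := hη 2
  set M := max (max K2 K4) 0
  have hM : 0 ≤ M := le_max_right _ _
  refine ⟨3 * M ^ 2 + M, by positivity, fun D => ?_⟩
  have h := (ex_sum_pow_four_le D.V (fun i => C (D.lam i ^ 2) * (D.psi i ^ 2 - 1)) hM
    (fun i => by rw [ex_C_mul, map_sub, D.psi_sq, ex_one, sub_self, mul_zero])
    (fun i => (h2 ⟨D, i⟩).trans ((le_max_left _ _).trans (le_max_left _ _)))
    (fun i => (h4 ⟨D, i⟩).trans ((le_max_right _ _).trans (le_max_left _ _)))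
    (fun i => mul_mem (Subalgebra.algebraMap_mem _ _)
      (sub_mem (pow_mem (D.psi_inv i) 2) (one_mem _)))
    (fun i j hij => mul_mem (Subalgebra.algebraMap_mem _ _)
      (sub_mem (pow_mem (D.psi_inv_of_ne i j hij) 2) (one_mem _))) Finset.univ).2.2
  rw [D.sqFluctuation_eq hk, mul_pow, ← map_pow, ex_C_mul]
  rw [Finset.card_univ, Fintype.card_fin] at h
  have hL := D.L_pos'
  calc _ ≤ (1 / (D.L : ℝ)) ^ 4 * ((3 * M ^ 2 + M) * D.L ^ 2) := by gcongr
    _ = _ := by field_simp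

/-- The weighted inequality `s² t² ≤ L s⁴ + t⁴ / L` balances `𝔼[s⁴] = O(L^{-2})` against the bounded
moments of `t = p^n`. -/
lemma small_sqFluctuation_mul (hk : k ≠ 0) (n : ℕ) :
    Small fun D : ChaosSum k B => D.sqFluctuation * D.p ^ n := by
  obtain ⟨K, hK, h⟩ := exists_ex_sqFluctuation_pow_four_le (B := B) hk
  obtain ⟨K', hK', h'⟩ := ((bddMoments_p (k := k) (B := B)).pow (2 * n)).exists_ex_sq_le
  refine ⟨K + K', by positivity, fun D => ?_⟩
  have hL := D.L_pos'
  calc _ ≤ ex (C (D.L : ℝ) * D.sqFluctuation ^ 4 + C (1 / (D.L : ℝ)) * (D.p ^ (2 * n)) ^ 2) := by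
        refine ex_mono fun x => ?_
        simp only [ev_mul, ev_pow, ev_add, ev_C]
        set s := ev D.sqFluctuation x
        set t := ev D.p x ^ n with ht
        have h1 : (s * t) ^ 2 = s ^ 2 * t ^ 2 := mul_pow _ _ _
        have h2 : (ev D.p x ^ (2 * n)) ^ 2 = (t ^ 2) ^ 2 := by rw [ht]; ring
        have h3 : s ^ 4 = (s ^ 2) ^ 2 := by ring
        rw [h1, h2, h3]
        have h4 : (D.L : ℝ) * (s ^ 2) ^ 2 + 1 / D.L * (t ^ 2) ^ 2 - s ^ 2 * t ^ 2
            = 1 / D.L * ((D.L * s ^ 2 - t ^ 2 / 2) ^ 2 + 3 / 4 * (t ^ 2) ^ 2) := by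
          field_simp; ring
        have h5 : 0 ≤ 1 / D.L * ((D.L * s ^ 2 - t ^ 2 / 2) ^ 2 + 3 / 4 * (t ^ 2) ^ 2) := by
          positivity
        linarith
    _ = D.L * ex (D.sqFluctuation ^ 4) + 1 / D.L * ex ((D.p ^ (2 * n)) ^ 2) := by
        rw [map_add ex, ex_C_mul, ex_C_mul]
    _ ≤ D.L * (K / D.L ^ 2) + 1 / D.L * K' := by gcongr; exacts [h D, h' D]
    _ = _ := by field_simp

/-- Each summand has second moment `O(L^{-3})`, and the square of a sum of `L` terms costs at most a
factor `L` over the sum of squares: no independence is needed. -/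
lemma small_sum_eps_pow_three_mul (n : ℕ) : Small fun D : ChaosSum k B =>
    ∑ i, D.eps i ^ 3 * powRemainder D.p (D.eps i) n := by
  obtain ⟨K, hK, h⟩ := (((bddMoments_lam_mul_psi (k := k) (B := B)).pow 3).mul
    (bddMoments_powRemainder n)).exists_ex_sq_le
  refine ⟨K, hK, fun D => (ex_sum_sq_le_card_mul _ _).trans ?_⟩
  have hL := D.L_pos'
  rw [Finset.card_univ, Fintype.card_fin]
  calc _ ≤ (D.L : ℝ) * ∑ i : Fin D.L, (1 / (D.L : ℝ)) ^ 3 * K := by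
        refine mul_le_mul_of_nonneg_left (Finset.sum_le_sum fun i _ => ?_) hL.le
        have : (D.eps i ^ 3 * powRemainder D.p (D.eps i) n) ^ 2 = C ((1 / (D.L : ℝ)) ^ 3) *
            ((C (D.lam i) * D.psi i) ^ 3 * powRemainder D.p (D.eps i) n) ^ 2 := by
          rw [← one_div_sqrt_sq, ← pow_mul, mul_comm 2 3, pow_mul]
          nth_rewrite 1 [eps_eq]
          simp only [map_pow]
          ring
        rw [this, ex_C_mul]
        exact mul_le_mul_of_nonneg_left (h ⟨D, i⟩) (by positivity)
    _ = _ := by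
        rw [Finset.sum_const, Finset.card_univ, Fintype.card_fin, nsmul_eq_mul]
        field_simp

/-- The deviation of `p^n` from its expected behavior on the chaoses of degree at most `k`. -/
noncomputable def defect (D : ChaosSum k B) (n : ℕ) : MvPolynomial (Fin D.d) ℝ :=
  D.p ^ n - C (gaussMoment n) - C (n * gaussMoment (n - 1)) * D.p

/-- One factor `p` is written as `∑ ε_i` and the other `n + 1` are expanded around `p - ε_i`.
Splitting `∑ ε_i²` as `1` plus its fluctuation gives the previous defect, and the Gaussian moment
recursion cancels the constant and linear terms. -/
lemma defect_add_two (D : ChaosSum k B) (n : ℕ) : D.defect (n + 2) =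
    ∑ i, D.eps i * ((D.p - D.eps i) ^ (n + 1) - C (gaussMoment (n + 1)))
      + C ((n : ℝ) + 1) * D.defect n + C ((n : ℝ) + 1) * (D.sqFluctuation * D.p ^ n)
      + C (-1) * ∑ i, D.eps i ^ 3 * powRemainder D.p (D.eps i) (n + 1) := by
  have h1 (i : Fin D.L) : D.eps i * ((D.p - D.eps i) ^ (n + 1) - C (gaussMoment (n + 1)))
      = D.eps i * D.p ^ (n + 1) - ((n : MvPolynomial (Fin D.d) ℝ) + 1) * (D.eps i ^ 2 * D.p ^ n)
        + D.eps i ^ 3 * powRemainder D.p (D.eps i) (n + 1)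
        - D.eps i * C (gaussMoment (n + 1)) := by
    rw [sub_pow_eq_powRemainder]
    push_cast
    ring
  simp only [h1, Finset.sum_add_distrib, Finset.sum_sub_distrib, ← Finset.sum_mul,
    ← Finset.mul_sum]
  rw [← p, sqFluctuation, defect, defect, gaussMoment_add_two]
  simp only [map_add, map_mul, map_natCast, map_one, map_neg,
    gaussMoment_succ n, Nat.add_succ_sub_one]
  push_cast
  ring

/-- By `chaosProj_mul` the second factors can be replaced by their means `b_i`. What remains is zero
for `j < k` and `∑ b_i ε_i` for `j = k`, with second moment at most `max b_i²`. Bounding `b_i`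
requires only the mean of the defect. -/
lemma small_chaosProj_sum_eps_mul (hk : k ≠ 0) (n : ℕ) {j : ℕ} (hj : j ≤ k)
    (h : Small fun D : ChaosSum k B => HierPoly.chaosProj 0 (D.defect n)) :
    Small fun D : ChaosSum k B => HierPoly.chaosProj j
      (∑ i, D.eps i * ((D.p - D.eps i) ^ n - C (gaussMoment n))) := by
  obtain ⟨K, hK, h⟩ := h
  have hp := (bddMoments_p (k := k) (B := B)).comp fun x : (D : ChaosSum k B) × Fin D.L => x.1
  obtain ⟨K', hK', h'⟩ := ((bddMoments_lam_mul_psi (k := k) (B := B)).mul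
    (((hp.pow (n - 1)).const_mul n).sub (bddMoments_eps.mul
      (bddMoments_powRemainder n)))).exists_ex_sq_le
  -- Removing `ε_i` from `p` changes the mean of the power by `O(L^{-1/2})`, and the linear part of
  -- the defect decomposition contributes nothing since `p` is centered.
  have key (D : ChaosSum k B) (i : Fin D.L) :
      ex ((D.p - D.eps i) ^ n - C (gaussMoment n)) ^ 2 ≤ (2 * K + 2 * K') / D.L := by
    have h1 : (D.p - D.eps i) ^ n - C (gaussMoment n)
        = (D.defect n + C (n * gaussMoment (n - 1)) * D.p) + C (-(1 / Real.sqrt D.L)) *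
          (C (D.lam i) * D.psi i *
            (C (n : ℝ) * D.p ^ (n - 1) - D.eps i * powRemainder D.p (D.eps i) n)) := by
      rw [sub_pow_eq_powRemainder, defect, map_neg, map_natCast]
      linear_combination (-(n * D.p ^ (n - 1)) + D.eps i * powRemainder D.p (D.eps i) n)
        * D.eps_eq i
    have h2 : ex (HierPoly.chaosProj 0 (D.defect n) ^ 2) ≤ K / D.L := h D
    rw [chaosProj_zero, ← map_pow, ex_C] at h2
    have h3 := (sq_ex_le _).trans (h' ⟨D, i⟩)
    rw [h1, map_add ex, map_add ex, ex_C_mul, ex_C_mul, ex_eq_zero hk D.p_mem, mul_zero, add_zero]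
    set a := ex (D.defect n)
    set b := ex (C (D.lam i) * D.psi i *
      (C (n : ℝ) * D.p ^ (n - 1) - D.eps i * powRemainder D.p (D.eps i) n))
    have h4 : (-(1 / Real.sqrt D.L) * b) ^ 2 ≤ K' / D.L := by
      rw [mul_pow, neg_sq, one_div_sqrt_sq, one_div, inv_mul_eq_div]
      exact div_le_div_of_nonneg_right h3 D.L_pos'.le
    have h5 : (2 * K + 2 * K') / (D.L : ℝ) = 2 * (K / D.L) + 2 * (K' / D.L) := by ring
    rw [h5]
    nlinarith [sq_nonneg (a - -(1 / Real.sqrt D.L) * b)]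
  refine ⟨2 * K + 2 * K', by positivity, fun D => ?_⟩
  have h1 (i : Fin D.L) : HierPoly.chaosProj j
      (D.eps i * ((D.p - D.eps i) ^ n - C (gaussMoment n)))
      = ex ((D.p - D.eps i) ^ n - C (gaussMoment n)) • HierPoly.chaosProj j (D.eps i) :=
    chaosProj_mul hj (D.eps_inv i)
      (sub_mem (pow_mem (D.p_sub_eps_inv i) n) (Subalgebra.algebraMap_mem _ _)) (D.eps_mem i)
  have hL := D.L_pos'
  simp only [map_sum, h1]
  by_cases hjk : j = k
  · subst hjk
    simp only [chaosProj_of_mem (D.eps_mem _), MvPolynomial.smul_eq_C_mul]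
    rw [ex_sum_C_mul_eps_sq hk]
    calc _ ≤ (∑ i, (2 * K + 2 * K') / D.L * D.lam i ^ 2) / (D.L : ℝ) := by
          gcongr with i
          exact key D i
      _ = _ := by
        rw [← Finset.mul_sum, D.sum_lam_sq hk]
        field_simp
  · simp only [chaosProj_of_mem_of_ne (Ne.symm hjk) (D.eps_mem _), smul_zero,
      Finset.sum_const_zero]
    simp
    positivity

/-- On the chaoses of degree at most `k`, the power `p^n` is `κ_n + n κ_{n-1} p` up to an error
`O(L^{-1/2})`, where `κ_n` is the `n`-th Gaussian moment. -/
lemma small_chaosProj_defect (hk : k ≠ 0) (n : ℕ) :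
    ∀ j ≤ k, Small fun D : ChaosSum k B => HierPoly.chaosProj j (D.defect n) := by
  -- Both base defects vanish identically.
  induction n using Nat.twoStepInduction with
  | zero =>
    intro j _
    simpa [defect] using small_zero (k := k) (B := B)
  | one =>
    intro j _
    simpa [defect] using small_zero (k := k) (B := B)
  | more n ih ih' =>
    intro j hj
    simp only [defect_add_two, map_add (HierPoly.chaosProj j)]
    -- Every degree `j` needs the degree `0` bound for the power `n + 1`, so the induction carries
    -- all `j ≤ k` together.
    have h1 := small_chaosProj_sum_eps_mul hk (n + 1) hj (ih' 0 (Nat.zero_le k))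
    have h2 := (ih j hj).const_mul ((n : ℝ) + 1)
    have h3 := ((small_sqFluctuation_mul (B := B) hk n).const_mul ((n : ℝ) + 1)).chaosProj j
    have h4 := ((small_sum_eps_pow_three_mul (k := k) (B := B) (n + 1)).const_mul (-1)).chaosProj j
    have := ((h1.add h2).add h3).add h4
    simpa only [← MvPolynomial.smul_eq_C_mul, map_smul] using this

end ChaosSum

/-! ### From powers to polynomials `g`, and back to features -/

lemma eLpNorm_ev {d : ℕ} (F : MvPolynomial (Fin d) ℝ) :
    eLpNorm (ev F) 2 (gam d) = ENNReal.ofReal (Real.sqrt (ex (F ^ 2))) := by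
  have hmem : MemLp (ev F) 2 (gam d) :=
    (memLp_two_iff_integrable_sq (continuous_ev F).aestronglyMeasurable).2
      ((integrable_ev (F ^ 2)).congr (Filter.Eventually.of_forall fun x => by simp))
  rw [hmem.eLpNorm_eq_integral_rpow_norm two_ne_zero ENNReal.ofNat_ne_top, Real.sqrt_eq_rpow,
    ex_apply]
  simp

lemma integral_eval_derivative_gaussianReal {g : Polynomial ℝ} {q : ℕ} (hg : g.natDegree ≤ q) :
    ∫ z, g.derivative.eval z ∂(gaussianReal 0 1)
      = ∑ m ∈ Finset.range (q + 1), g.coeff m * (m * gaussMoment (m - 1)) := by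
  have h (z : ℝ) : g.derivative.eval z
      = ∑ m ∈ Finset.range (q + 1), g.coeff m * m * z ^ (m - 1) := by
    rw [Polynomial.derivative_eval]
    exact g.sum_over_range' (by simp) (q + 1) (by omega)
  simp only [h]
  rw [integral_finsetSum _ fun m _ => (integrable_pow_gaussianReal _).const_mul _]
  simp only [integral_const_mul, mul_assoc]
  rfl

lemma ev_aeval {d : ℕ} (F : MvPolynomial (Fin d) ℝ) (g : Polynomial ℝ) (x : E d) :
    ev (Polynomial.aeval F g) x = g.eval (ev F x) := by
  rw [ev, ← MvPolynomial.coe_aeval_eq_eval, RingHom.coe_coe, ← Polynomial.aeval_algHom_apply,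
    Polynomial.coe_aeval_eq_eval]
  rfl

namespace ChaosSum

variable {k : ℕ} {B : ℝ}

lemma aeval_p_eq (D : ChaosSum k B) {g : Polynomial ℝ} {q : ℕ} (hg : g.natDegree ≤ q) :
    Polynomial.aeval D.p g = ∑ m ∈ Finset.range (q + 1), C (g.coeff m) * D.defect m
      + (∑ m ∈ Finset.range (q + 1), g.coeff m * gaussMoment m) •
        (1 : MvPolynomial (Fin D.d) ℝ)
      + (∫ z, g.derivative.eval z ∂(gaussianReal 0 1)) • D.p := by
  rw [integral_eval_derivative_gaussianReal hg, MvPolynomial.smul_eq_C_mul,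
    MvPolynomial.smul_eq_C_mul, mul_one, map_sum, map_sum, Finset.sum_mul,
    ← Finset.sum_add_distrib, ← Finset.sum_add_distrib,
    Polynomial.aeval_eq_sum_range' (Nat.lt_succ_of_le hg)]
  refine Finset.sum_congr rfl fun m _ => ?_
  rw [MvPolynomial.smul_eq_C_mul, defect]
  simp only [map_mul]
  ring

lemma exists_ex_chaosProj_sum_defect_le (hk : k ≠ 0) (q : ℕ) (G : ℝ) {j : ℕ} (hj : j ≤ k) :
    ∃ K : ℝ, 0 ≤ K ∧ ∀ (D : ChaosSum k B) (g : Polynomial ℝ), (∀ i, |g.coeff i| ≤ G) →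
      ex (HierPoly.chaosProj j (∑ m ∈ Finset.range (q + 1), C (g.coeff m) * D.defect m) ^ 2)
        ≤ K / D.L := by
  choose K hK h using fun n => small_chaosProj_defect (B := B) hk n j hj
  refine ⟨(q + 1 : ℝ) * ∑ m ∈ Finset.range (q + 1), G ^ 2 * K m,
    mul_nonneg (by positivity) (Finset.sum_nonneg fun m _ => mul_nonneg (sq_nonneg G) (hK m)),
    fun D g hg => ?_⟩
  rw [map_sum]
  refine (ex_sum_sq_le_card_mul _ _).trans ?_
  rw [Finset.card_range, mul_div_assoc, Finset.sum_div]
  push_cast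
  refine mul_le_mul_of_nonneg_left (Finset.sum_le_sum fun m _ => ?_) (by positivity)
  rw [← MvPolynomial.smul_eq_C_mul, map_smul, MvPolynomial.smul_eq_C_mul, mul_pow, ← map_pow,
    ex_C_mul, mul_div_assoc]
  refine mul_le_mul ?_ (h m D) (ex_sq_nonneg _) (sq_nonneg G)
  rw [← sq_abs]
  exact pow_le_pow_left₀ (abs_nonneg _) (hg m) 2

/-- The approximate Stein lemma for polynomials of a normalized sum in the `k`-th chaos. -/
lemma exists_stein_bound (hk : k ≠ 0) (q : ℕ) (G : ℝ) :
    ∃ K : ℝ, 0 ≤ K ∧ ∀ (D : ChaosSum k B) (g : Polynomial ℝ), g.natDegree ≤ q →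
      (∀ i, |g.coeff i| ≤ G) → ex (Polynomial.aeval D.p g) = 0 →
      ex ((HierPoly.chaosProj k (Polynomial.aeval D.p g)
        - (∫ z, g.derivative.eval z ∂(gaussianReal 0 1)) • D.p) ^ 2) ≤ K / D.L ∧
      ex ((∑ j ∈ Finset.range k, HierPoly.chaosProj j (Polynomial.aeval D.p g)) ^ 2)
        ≤ K / D.L := by
  choose! K hK h using fun (j : ℕ) (hj : j ≤ k) =>
    exists_ex_chaosProj_sum_defect_le (B := B) hk q G hj
  have hsum : 0 ≤ k * ∑ j ∈ Finset.range k, K j :=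
    mul_nonneg (by positivity) (Finset.sum_nonneg fun j hj => hK j (Finset.mem_range.1 hj).le)
  refine ⟨K k + k * ∑ j ∈ Finset.range k, K j, add_nonneg (hK k le_rfl) hsum,
    fun D g hgq hgG h0 => ?_⟩
  have hL := D.L_pos'
  constructor
  · rw [aeval_p_eq D hgq, map_add, map_add, map_smul, map_smul, chaosProj_of_mem D.p_mem,
      chaosProj_of_mem_of_ne hk.symm one_mem_chaos, smul_zero, add_zero, add_sub_cancel_right]
    refine (h k le_rfl D g hgG).trans ?_
    gcongr
    linarith
  · refine (ex_sum_sq_le_card_mul _ _).trans ?_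
    rw [Finset.card_range]
    have h1 : ∀ j ∈ Finset.range k,
        ex (HierPoly.chaosProj j (Polynomial.aeval D.p g) ^ 2) ≤ K j / D.L := by
      intro j hj
      have hjk := Finset.mem_range.1 hj
      -- In degree `0` the constant `∑ g_m κ_m` of the decomposition survives, so the centering
      -- assumption is used directly. In degrees `0 < j < k` both the constant and the multiple of
      -- `p` project to zero.
      rcases eq_or_ne j 0 with rfl | hj0
      · rw [chaosProj_zero, h0]
        simpa using div_nonneg (hK 0 (Nat.zero_le k)) hL.le
      · rw [aeval_p_eq D hgq, map_add, map_add, map_smul, map_smul,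
          chaosProj_of_mem_of_ne hjk.ne' D.p_mem, chaosProj_of_mem_of_ne hj0.symm one_mem_chaos,
          smul_zero, smul_zero, add_zero, add_zero]
        exact h j hjk.le D g hgG
    calc _ ≤ (k : ℝ) * ∑ j ∈ Finset.range k, K j / D.L :=
          mul_le_mul_of_nonneg_left (Finset.sum_le_sum h1) (by positivity)
      _ = (k * ∑ j ∈ Finset.range k, K j) / D.L := by rw [← Finset.sum_div, mul_div_assoc]
      _ ≤ _ := by
        gcongr
        linarith [hK k le_rfl]

end ChaosSum

/-- A feature satisfying the assumptions is a normalized sum of independent polynomials. -/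
lemma FeatureAssumption.exists_psi {k : ℕ} {B c₁ c₂ : ℝ} {d L : ℕ} {J : Fin L → ℕ}
    {v : (i : Fin L) → Fin (J i) → E d} {lam : Fin L → ℝ} {ψ : Fin L → E d → ℝ}
    (h : FeatureAssumption k B c₁ c₂ d L J v lam ψ) :
    ∃ psi : Fin L → MvPolynomial (Fin d) ℝ, (∀ i, ev (psi i) = ψ i) ∧
      (∀ i, psi i ∈ chaos d k) ∧
      (∀ i, psi i ∈ invariantPoly (Submodule.span ℝ (Set.range (v i)))ᗮ) ∧
      (∀ i j, i ≠ j → psi j ∈ invariantPoly (Submodule.span ℝ (Set.range (v i)))) := by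
  choose psi hmem hpsi using fun i => exists_chaos_of_hermiteProj_eq (h.proj_eq i)
  refine ⟨psi, hpsi, hmem, fun i w hw x => ?_, fun i j hij w hw x => ?_⟩
  · rw [hpsi]
    refine h.dependsOn i _ _ fun l => ?_
    rw [inner_add_right, (Submodule.mem_orthogonal _ _).1 hw _
      (Submodule.subset_span ⟨l, rfl⟩), add_zero]
  · rw [hpsi]
    refine h.dependsOn j _ _ fun l => ?_
    have hw' : inner ℝ (v j l) w = 0 := by
      refine Submodule.span_induction ?_ (by simp) ?_ ?_ hw
      · rintro _ ⟨m, rfl⟩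
        refine h.orthonormal.2 (i := ⟨j, l⟩) (j := ⟨i, m⟩) fun heq => hij ?_
        exact (congrArg Sigma.fst heq).symm
      · intro a b _ _ ha hb
        rw [inner_add_right, ha, hb, add_zero]
      · intro r a _ ha
        rw [inner_smul_right, ha, mul_zero]
    rw [inner_add_right, hw', add_zero]

lemma FeatureAssumption.card_pos {k : ℕ} {B c₁ c₂ : ℝ} {d L : ℕ} {J : Fin L → ℕ}
    {v : (i : Fin L) → Fin (J i) → E d} {lam : Fin L → ℝ} {ψ : Fin L → E d → ℝ}
    (h : FeatureAssumption k B c₁ c₂ d L J v lam ψ) : 0 < L := by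
  rcases Nat.eq_zero_or_pos L with rfl | hL
  · have := h.feature_normalized
    simp [feature] at this
  · exact hL

/-- The lower bound on `L` converts the rate `L^{-1/2}` into `d^{-1/2}`. -/
lemma eLpNorm_ev_le_of_ex_sq_le {d L : ℕ} {F : MvPolynomial (Fin d) ℝ} {K c : ℝ} (hK : 0 ≤ K)
    (hc : 0 < c) (hd : 0 < d) (hL : c * d ≤ L) (hF : ex (F ^ 2) ≤ K / L) :
    eLpNorm (ev F) 2 (gam d)
      ≤ ENNReal.ofReal ((Real.sqrt (K / c) + 1) * (d : ℝ) ^ (-(1 / 2 : ℝ))) := by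
  rw [eLpNorm_ev]
  refine ENNReal.ofReal_le_ofReal ?_
  have hd' : (0 : ℝ) < d := Nat.cast_pos.2 hd
  have h1 : ex (F ^ 2) ≤ K / c / d := by
    refine hF.trans ?_
    rw [div_div]
    exact div_le_div_of_nonneg_left hK (mul_pos hc hd') hL
  calc _ ≤ Real.sqrt (K / c / d) := Real.sqrt_le_sqrt h1
    _ = Real.sqrt (K / c) * (d : ℝ) ^ (-(1 / 2 : ℝ)) := by
      rw [Real.sqrt_div (by positivity), Real.rpow_neg hd'.le, ← Real.sqrt_eq_rpow, div_eq_mul_inv]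
    _ ≤ _ := by gcongr; linarith

end HierPoly

open HierPoly in
theorem lemma4p2 (k q : ℕ) (hk : 2 ≤ k) (G B c₁ c₂ : ℝ) (hc₁ : 0 < c₁) :
    ∃ C : ℝ, 0 < C ∧
      ∀ (d L : ℕ) (J : Fin L → ℕ) (v : (i : Fin L) → Fin (J i) → HierPoly.E d)
        (lam : Fin L → ℝ) (ψ : Fin L → HierPoly.E d → ℝ) (g : Polynomial ℝ),
        HierPoly.FeatureAssumption k B c₁ c₂ d L J v lam ψ →
        g.natDegree ≤ q →
        (∀ i, |g.coeff i| ≤ G) →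
        ∫ x, g.eval (HierPoly.feature lam ψ x) ∂(HierPoly.gam d) = 0 →
        eLpNorm (fun x =>
            HierPoly.hermiteProj k (fun y => g.eval (HierPoly.feature lam ψ y)) x
              - (∫ z, g.derivative.eval z ∂(gaussianReal 0 1)) * HierPoly.feature lam ψ x)
            2 (HierPoly.gam d) ≤ ENNReal.ofReal (C * (d : ℝ) ^ (-(1 / 2 : ℝ))) ∧
        eLpNorm (HierPoly.hermiteProjLT k (fun y => g.eval (HierPoly.feature lam ψ y)))
            2 (HierPoly.gam d) ≤ ENNReal.ofReal (C * (d : ℝ) ^ (-(1 / 2 : ℝ))) := by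
  obtain ⟨K, hK, hbound⟩ := ChaosSum.exists_stein_bound (B := B) (k := k) (by omega) q G
  -- The `+ 1` keeps the constant positive when `K = 0`.
  refine ⟨Real.sqrt (K / c₁) + 1, by positivity, fun d L J v lam ψ g hA hgq hgG h0 => ?_⟩
  obtain ⟨psi, hev, hmem, hinv, hinv'⟩ := hA.exists_psi
  have hL := hA.card_pos
  -- The rate `d^{-1/2}` is meaningful only for `d > 0`; since `L > 0`, the upper bound `L ≤ c₂ d`
  -- excludes `d = 0`.
  have hd : 0 < d := by
    rcases Nat.eq_zero_or_pos d with rfl | hd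
    · have h1 := hA.card_le_mul
      rw [Nat.cast_zero, mul_zero] at h1
      exact absurd (Nat.cast_pos.2 hL) h1.not_gt
    · exact hd
  have hfeat : feature lam ψ
      = ev (∑ i, MvPolynomial.C (lam i / Real.sqrt L) * psi i) := by
    ext x
    simp only [feature, ev_sum, ev_mul, ev_C, hev, Finset.mul_sum]
    exact Finset.sum_congr rfl fun i _ => by ring
  let D : ChaosSum k B :=
    { d := d
      L := L
      lam := lam
      psi := psi
      V := fun i => Submodule.span ℝ (Set.range (v i))
      L_pos := hL
      psi_mem := hmem
      psi_inv := hinv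
      psi_inv_of_ne := hinv'
      psi_sq := fun i => by simpa [ex_apply, hev] using hA.component_normalized i
      abs_lam_le := hA.balanced
      sum_sq := by simpa only [ex_apply, ev_pow, ← hfeat] using hA.feature_normalized }
  have hp : feature lam ψ = ev D.p := hfeat
  have hg : (fun y => g.eval (feature lam ψ y)) = ev (Polynomial.aeval D.p g) := by
    ext x
    rw [hp, ev_aeval]
  have h0' : ex (Polynomial.aeval D.p g) = 0 := by
    rw [hg] at h0
    exact h0
  obtain ⟨h1, h2⟩ := hbound D g hgq hgG h0'
  constructor
  · convert eLpNorm_ev_le_of_ex_sq_le hK hc₁ hd hA.le_card h1 using 2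
    ext x
    rw [hg, hermiteProj_ev, hp, ev_sub, ev_smul]
  · convert eLpNorm_ev_le_of_ex_sq_le hK hc₁ hd hA.le_card h2 using 2
    ext x
    simp only [hermiteProjLT, hg, hermiteProj_ev, ev_sum]
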